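/- Let $\omega=(\omega_x)_{x\in\mathbb Z}\in[0,1]^{\mathbb Z}$ be i.i.d. with law $\alpha$, and let $\rho_x=(1-\omega_x)/\omega_x\in[0,\infty]$ and $\Pi_{i,j}=\prod_{k=i}^{j}\rho_k$. For a fixed environment $\omega$, let $P_\omega^x$ (with expectation $E_\omega^x$) be the law of the nearest-neighbour Markov chain $(X_n)_{n\ge0}$ on $\mathbb Z$ with $X_0=x$ that jumps from $y$ to $y+1$ with probability $\omega_y$ and to $y-1$ with probability $1-\omega_y$, and let $T_y=\inf\{n\ge 0: X_n=y\}$. Assume that, for some $s>1$, $$E_\alpha[\log\rho_0]<0,\qquad E_\alpha[\rho_0^s]=1,\qquad E_\alpha[\rho_0^s\log\rho_0]<\infty,$$ and that $\log\rho_0$ is non-lattice (there is no $h>0$ such that $\log\rho_0\in h\mathbb Z$ almost surely). Define the ladder points $(\nu_i)_{i\in\mathbb Z}$ of $\omega$ by $\nu_0=\sup\{y\le 0:\Pi_{k,y-1}<1\ \forall k<y\}$ and, for $i\ge1$, $\nu_i=\inf\{x>\nu_{i-1}:\Pi_{\nu_{i-1},x-1}<1\}$ and $\nu_{-i}=\sup\{y<\nu_{-i+1}:\Pi_{k,y-1}<1\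 \forall k<y\}$. Let $$M_i=\max\{\Pi_{\nu_i,j}:\nu_i\le j<\nu_{i+1}\},\qquad \beta_i=E_\omega^{\nu_i}[T_{\nu_{i+1}}],\qquad Q(\cdot)=\alpha(\,\cdot\mid\nu_0=0).$$ Then $\alpha(\nu_0=0)>0$ and $E_Q[\beta_0]<\infty$. Moreover, let $\eta_1>\eta_2>0$, $a_n=n^{\eta_1}$ and $b_n=n^{\eta_2}$. Then for every $\varepsilon>0$ there are constants $C,C'>0$ such that, for all integers $n\ge1$, $$Q\Bigl(\sum_{0\le i<a_n}\bigl(\beta_i\mathbf 1_{\{M_i\le b_n\}}-E_Q[\beta_0]\bigr)>\varepsilon a_n\Bigr)\le C'a_n e^{-C(\log n)^2}.$$ -/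

import Mathlib

open MeasureTheory ProbabilityTheory
open scoped ENNReal

noncomputable section

namespace RWRE

/-- An environment `ω = (ω_x)_{x ∈ ℤ}`, an element of `[0,1]^ℤ`. -/
abbrev Env : Type := ℤ → Set.Icc (0 : ℝ) 1

/-- `(1 - p) / p` in `[0, ∞]` (equal to `∞` exactly when `p = 0`, to `0` exactly when `p = 1`). -/
def odds (p : Set.Icc (0 : ℝ) 1) : ℝ≥0∞ :=
  ENNReal.ofReal (1 - (p : ℝ)) / ENNReal.ofReal (p : ℝ)

/-- `ρ_x = (1 - ω_x) / ω_x`. -/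
def rho (ω : Env) (x : ℤ) : ℝ≥0∞ := odds (ω x)

/-- `Π_{i,j} = ∏_{k = i}^{j} ρ_k`. -/
def rhoProd (ω : Env) (i j : ℤ) : ℝ≥0∞ := ∏ k ∈ Finset.Icc i j, rho ω k

/-- The law `α` of an i.i.d. environment whose coordinates have law `μ`. -/
def envLaw (μ : Measure (Set.Icc (0 : ℝ) 1)) : Measure Env :=
  Measure.infinitePi fun _ : ℤ => μ

/-- First standing assumption: `E[log ρ_0] < 0` and `E[ρ_0 ^ s] = 1` with `s > 1`. The expectation of
`log ρ_0 ∈ [-∞, ∞]` may be `-∞`; that it exists and is negative means that the expectation of the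
positive part is less than the expectation of the negative part. -/
def BallisticAssumption (μ : Measure (Set.Icc (0 : ℝ) 1)) (s : ℝ) : Prop :=
  1 < s ∧
  ∫⁻ p, (ENNReal.log (odds p)).toENNReal ∂μ < ∫⁻ p, (-ENNReal.log (odds p)).toENNReal ∂μ ∧
  ∫⁻ p, odds p ^ s ∂μ = 1

/-- Second standing assumption: `log ρ_0` is non-lattice, that is, it is not almost surely in `h ℤ` for
any `h > 0`, and `E[ρ_0 ^ s log ρ_0] < ∞` (the function `r ^ s log r`, which is `0` at `r = 0`, is
bounded below, so this is integrability). -/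
def RegularityAssumption (μ : Measure (Set.Icc (0 : ℝ) 1)) (s : ℝ) : Prop :=
  (∀ h : ℝ, 0 < h → ¬ ∀ᵐ p ∂μ, ∃ k : ℤ, ENNReal.log (odds p) = (((k : ℝ) * h : ℝ) : EReal)) ∧
  Integrable (fun p => (odds p).toReal ^ s * Real.log (odds p).toReal) μ

/-! ### Ladder points -/

/-- `ν_n` for `n = 0, 1, 2, …`. In terms of the potential `V`, `Π_{k,y-1} < 1` says `V y < V k`; the form
with products also makes sense if some `ρ_x` vanish. -/
def ladderPos (ω : Env) : ℕ → ℤ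
  | 0 => sSup {y : ℤ | y ≤ 0 ∧ ∀ k < y, rhoProd ω k (y - 1) < 1}
  | n + 1 => sInf {x : ℤ | ladderPos ω n < x ∧ rhoProd ω (ladderPos ω n) (x - 1) < 1}

/-- `ν_{-n}` for `n = 0, 1, 2, …`. -/
def ladderNeg (ω : Env) : ℕ → ℤ
  | 0 => ladderPos ω 0
  | n + 1 => sSup {y : ℤ | y < ladderNeg ω n ∧ ∀ k < y, rhoProd ω k (y - 1) < 1}

/-- The ladder points `ν_i`, `i ∈ ℤ`. -/
def ladder (ω : Env) : ℤ → ℤ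
  | Int.ofNat n => ladderPos ω n
  | Int.negSucc n => ladderNeg ω (n + 1)

/-- `M_i = max {exp (V j - V ν_i) : ν_i < j ≤ ν_{i+1}} = max {Π_{ν_i,j} : ν_i ≤ j < ν_{i+1}}`. -/
def height (ω : Env) (i : ℤ) : ℝ≥0∞ :=
  ⨆ j ∈ Set.Ico (ladder ω i) (ladder ω (i + 1)), rhoProd ω (ladder ω i) j

/-- `Q = α(· | ν_0 = 0)`. -/
def ladderLaw (μ : Measure (Set.Icc (0 : ℝ) 1)) : Measure Env :=
  cond (envLaw μ) {ω | ladder ω 0 = 0}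

/-! ### The quenched random walk -/

/-- The transition kernel of the walk in the environment `ω`: from `x`, go to `x + 1` with probability
`ω_x` and to `x - 1` with probability `1 - ω_x`. -/
def step (ω : Env) : Kernel ℤ ℤ where
  toFun x := ENNReal.ofReal (ω x : ℝ) • Measure.dirac (x + 1) +
    ENNReal.ofReal (1 - (ω x : ℝ)) • Measure.dirac (x - 1)
  measurable' := Measurable.of_discrete

instance (ω : Env) : IsMarkovKernel (step ω) := ⟨fun x => ⟨by
  have h0 : (0 : ℝ) ≤ (ω x : ℝ) := (ω x).2.1
  have h1 : (0 : ℝ) ≤ 1 - (ω x : ℝ) := sub_nonneg.2 (ω x).2.2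
  change (ENNReal.ofReal (ω x : ℝ) • Measure.dirac (x + 1) +
    ENNReal.ofReal (1 - (ω x : ℝ)) • Measure.dirac (x - 1) : Measure ℤ) Set.univ = 1
  simp [← ENNReal.ofReal_add h0 h1]⟩⟩

/-- The law of `X_{n+1}` given `X_0, …, X_n`, namely `step ω` applied to `X_n`. -/
def stepFromPast (ω : Env) (n : ℕ) : Kernel (Finset.Iic n → ℤ) ℤ :=
  (step ω).comap (fun h => h ⟨n, Finset.mem_Iic.2 le_rfl⟩) (measurable_pi_apply _)

instance (ω : Env) (n : ℕ) : IsMarkovKernel (stepFromPast ω n) := by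
  unfold stepFromPast; infer_instance

/-- The quenched law `P_ω^x` on paths `(X_n)_{n ∈ ℕ}`, with `X_0 = x`. -/
def quenchedLaw (ω : Env) (x : ℤ) : Measure (ℕ → ℤ) :=
  Kernel.traj (X := fun _ => ℤ) (stepFromPast ω) 0 fun _ => x

/-- The hitting time `T_y = inf {n ≥ 0 : X_n = y}`, equal to `∞` if `y` is never hit. -/
def hitTime (y : ℤ) (X : ℕ → ℤ) : ℝ≥0∞ := ⨅ (n : ℕ) (_ : X n = y), (n : ℝ≥0∞)

/-- `β_i = E_ω^{ν_i}[T_{ν_{i+1}}]`. -/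
def crossing (ω : Env) (i : ℤ) : ℝ≥0∞ :=
  ∫⁻ X, hitTime (ladder ω (i + 1)) X ∂(quenchedLaw ω (ladder ω i))

/-- `E_Q[β_0]`. -/
def meanCrossing (μ : Measure (Set.Icc (0 : ℝ) 1)) : ℝ≥0∞ :=
  ∫⁻ ω, crossing ω 0 ∂(ladderLaw μ)

/-- The truncated crossing time `β_i 1{M_i ≤ b}`. -/
def smallCrossing (b : ℝ) (ω : Env) (i : ℤ) : ℝ≥0∞ :=
  {ω' : Env | height ω' i ≤ ENNReal.ofReal b}.indicator (fun ω' => crossing ω' i) ω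

end RWRE

end

/-! The proof reduces the block crossing times to an affine recursion with contracting mean and then
runs an exponential supermartingale argument on it. Strict convexity of `t ↦ t ^ s` turns `E[ρ_0 ^
s] = 1` with negative log-drift into `E[ρ_0] < 1` (`lintegral_odds_lt_one`), and every moment and
tail bound below comes from that inequality.

Quenched side: let `W_x = ρ_{x-1} + ρ_{x-1} ρ_{x-2} + ⋯` be the past sum. Then `W_{x+1} = ρ_x (1 +
W_x)`, and the mean time to go from `x` to `x + 1` is `1 + 2 W_{x+1}` (`lintegral_hitTime_eq`). The
crossing time of a block therefore depends only on the past sum `w` at its start and on the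
environment inside the block, and it is affine in `w`, of the form `X + Y w`. The past sum at the
end of the block is also affine, `S + R w`, where `R` is the product of the odds over the block, so
`R < 1` almost surely.

Environment side: being a ladder point constrains only the environment to the left. Under `Q` the
pair (past sum, future) is therefore a product, and passing to the next ladder point preserves its
law (`measurePreserving_advance`). With `v` the stationary mean of the past sum, `v = E[S] + E[R] v`
and `E_Q[β_0] = E[X] + E[Y] v`, which is finite.

Large deviations: call a state moderate at level `h` if its past sum is at most `2 h` and its block
has length at most `h`. A state is not moderate with probability exponentially small in `h`. On
moderate states the crossing time truncated at height `b` is at most `7 h² b`. For `l` of order `1 /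
(h² b)`, the exponential of `l` times (truncated crossing time `+ c ·` next past sum) has mean at
most `exp (l (κ + c w))`. Here `c` makes the past sum absorb its own influence on later blocks, and
`κ` can be taken as close to `E_Q[β_0]` as desired (`lintegral_exp_step_le`, `exists_drift`).
Iterating over the blocks and applying Markov's inequality gives `measure_truncCrossing_sum_le`.
Taking `h` of order `(log n)²`, the non-moderate states cost `a_n exp (-C (log n)²)`, and the
exponential term is smaller still, because `a_n / (h² b_n)` is a positive power of `n` up to
logarithms. -/

noncomputable section

namespace RWRE

/-! ### Environments seen from a point -/

/-- The product of the first `k` odds of a one-sided environment. -/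
def prefixProd (η : ℕ → Set.Icc (0 : ℝ) 1) (k : ℕ) : ℝ≥0∞ := ∏ i ∈ Finset.range k, odds (η i)

/-- The affine recursion `w ↦ ρ (1 + w)` run along a one-sided environment. -/
def accum (w : ℝ≥0∞) (η : ℕ → Set.Icc (0 : ℝ) 1) : ℕ → ℝ≥0∞
  | 0 => w
  | k + 1 => odds (η k) * (1 + accum w η k)

/-- The stationary solution of the affine recursion, read off the environment to the left. -/
def pastSum (ζ : ℕ → Set.Icc (0 : ℝ) 1) : ℝ≥0∞ := ∑' k, prefixProd ζ (k + 1)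

/-- The environment strictly to the left of `y`, read leftwards. -/
def past (ω : Env) (y : ℤ) : ℕ → Set.Icc (0 : ℝ) 1 := fun k => ω (y - 1 - k)

/-- The environment to the right of `y`, starting with `y` itself. -/
def future (ω : Env) (y : ℤ) : ℕ → Set.Icc (0 : ℝ) 1 := fun k => ω (y + k)

@[simp] lemma prefixProd_zero (η : ℕ → Set.Icc (0 : ℝ) 1) : prefixProd η 0 = 1 := by
  simp [prefixProd]

lemma prefixProd_succ (η : ℕ → Set.Icc (0 : ℝ) 1) (k : ℕ) :
    prefixProd η (k + 1) = prefixProd η k * odds (η k) := by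
  simp [prefixProd, Finset.prod_range_succ]

lemma prefixProd_past_succ (ω : Env) (x : ℤ) (k : ℕ) :
    prefixProd (past ω (x + 1)) (k + 1) = odds (ω x) * prefixProd (past ω x) k := by
  rw [prefixProd, Finset.prod_range_succ', mul_comm]
  congr 1
  · simp [past]
  · refine Finset.prod_congr rfl fun i _ => ?_
    simp only [past]
    congr 2
    push_cast
    ring

lemma pastSum_past_succ (ω : Env) (x : ℤ) :
    pastSum (past ω (x + 1)) = odds (ω x) * (1 + pastSum (past ω x)) := by
  simp only [pastSum, prefixProd_past_succ, ENNReal.tsum_mul_left]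
  rw [tsum_eq_zero_add' ENNReal.summable, prefixProd_zero]

/-- The left half of the environment acts on later past sums only through the single number at `x`;
this is what makes the pair (past sum, future) a Markovian state. -/
lemma accum_pastSum (ω : Env) (x : ℤ) (k : ℕ) :
    accum (pastSum (past ω x)) (future ω x) k = pastSum (past ω (x + k)) := by
  induction k with
  | zero => simp [accum]
  | succ k ih =>
    rw [accum, ih, Nat.cast_succ, ← add_assoc, pastSum_past_succ]
    rfl

/-! ### Quenched hitting times -/

/-- `P_ω^x (T_y > n)`, defined by the backward recursion. -/
def survival (ω : Env) (y : ℤ) : ℕ → ℤ → ℝ≥0∞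
  | 0, x => if x = y then 0 else 1
  | n + 1, x => if x = y then 0 else
      ENNReal.ofReal (ω x : ℝ) * survival ω y n (x + 1) +
        ENNReal.ofReal (1 - (ω x : ℝ)) * survival ω y n (x - 1)

lemma ofReal_add_ofReal_one_sub (p : Set.Icc (0 : ℝ) 1) :
    ENNReal.ofReal (p : ℝ) + ENNReal.ofReal (1 - (p : ℝ)) = 1 := by
  rw [← ENNReal.ofReal_add p.2.1 (sub_nonneg.2 p.2.2)]
  simp

lemma lintegral_step (ω : Env) (x : ℤ) (f : ℤ → ℝ≥0∞) :
    ∫⁻ z, f z ∂(step ω x) =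
      ENNReal.ofReal (ω x : ℝ) * f (x + 1) + ENNReal.ofReal (1 - (ω x : ℝ)) * f (x - 1) := by
  change ∫⁻ z, f z ∂(ENNReal.ofReal (ω x : ℝ) • Measure.dirac (x + 1) +
    ENNReal.ofReal (1 - (ω x : ℝ)) • Measure.dirac (x - 1) : Measure ℤ) = _
  simp [lintegral_add_measure]

lemma quenchedLaw_ae_zero (ω : Env) (x : ℤ) : ∀ᵐ X ∂quenchedLaw ω x, X 0 = x := by
  have h := Kernel.traj_map_frestrictLe_apply (X := fun _ : ℕ => ℤ) (κ := stepFromPast ω) 0 0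
    (fun _ => x)
  rw [Kernel.partialTraj_self, Kernel.id_apply] at h
  have h2 : ∀ᵐ Y ∂(quenchedLaw ω x).map (Preorder.frestrictLe (π := fun _ : ℕ => ℤ) 0),
      Y ⟨0, by simp⟩ = x := by
    rw [quenchedLaw, h]
    rw [ae_dirac_iff]
    exact measurableSet_eq_fun (by fun_prop) (by fun_prop)
  exact ae_of_ae_map (by fun_prop) h2

/-- The Markov property at a fixed time. -/
lemma lintegral_quenchedLaw_succ (ω : Env) (x : ℤ) (n : ℕ)
    (s : Set (Finset.Iic n → ℤ)) (hs : MeasurableSet s) (f : ℤ → ℝ≥0∞) :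
    ∫⁻ X, s.indicator 1 (Preorder.frestrictLe n X) * f (X (n + 1)) ∂quenchedLaw ω x =
      ∫⁻ X, s.indicator 1 (Preorder.frestrictLe n X) *
        (ENNReal.ofReal (ω (X n) : ℝ) * f (X n + 1) +
          ENNReal.ofReal (1 - (ω (X n) : ℝ)) * f (X n - 1)) ∂quenchedLaw ω x := by
  have hf : Measurable f := Measurable.of_discrete
  have h1 : Measurable (s.indicator (1 : (Finset.Iic n → ℤ) → ℝ≥0∞)) :=
    measurable_one.indicator hs
  have h := Kernel.partialTraj_compProd_eq_map_traj (X := fun _ : ℕ => ℤ) (κ := stepFromPast ω)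
    (Nat.zero_le n) (x₀ := fun _ => x)
  have e1 : ∫⁻ X, s.indicator 1 (Preorder.frestrictLe n X) * f (X (n + 1)) ∂quenchedLaw ω x =
      ∫⁻ z, s.indicator 1 z.1 * f z.2 ∂((quenchedLaw ω x).map
        (fun X => (Preorder.frestrictLe (π := fun _ : ℕ => ℤ) n X, X (n + 1)))) := by
    rw [lintegral_map (by fun_prop) (by fun_prop)]
  rw [e1, quenchedLaw, ← h, Measure.lintegral_compProd (by fun_prop),
    ← Kernel.traj_map_frestrictLe_apply, lintegral_map ?_ (by fun_prop)]
  · refine lintegral_congr fun X => ?_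
    simp only [lintegral_const_mul _ hf, stepFromPast, Kernel.comap_apply, lintegral_step]
    rfl
  · have : ∀ a : Finset.Iic n → ℤ, ∫⁻ b, s.indicator 1 a * f b ∂(stepFromPast ω n a) =
      s.indicator 1 a * (ENNReal.ofReal (ω (a ⟨n, by simp⟩) : ℝ) * f (a ⟨n, by simp⟩ + 1) +
          ENNReal.ofReal (1 - (ω (a ⟨n, by simp⟩) : ℝ)) * f (a ⟨n, by simp⟩ - 1)) := by
      intro a
      rw [lintegral_const_mul _ hf, stepFromPast, Kernel.comap_apply, lintegral_step]
    simp_rw [this]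
    refine h1.mul ?_
    exact (Measurable.of_discrete (f := fun m : ℤ => ENNReal.ofReal (ω m : ℝ) * f (m + 1) +
          ENNReal.ofReal (1 - (ω m : ℝ)) * f (m - 1))).comp (measurable_pi_apply _)

lemma measurableSet_avoid (y : ℤ) (n : ℕ) : MeasurableSet {X : ℕ → ℤ | ∀ k ≤ n, X k ≠ y} := by
  have : {X : ℕ → ℤ | ∀ k ≤ n, X k ≠ y} = ⋂ k, ⋂ (_ : k ≤ n), {X | X k = y}ᶜ := by
    ext; simp
  rw [this]
  exact MeasurableSet.iInter fun k => MeasurableSet.iInter fun _ =>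
    (measurableSet_eq_fun (by fun_prop) (by fun_prop)).compl

/-- The Markov property moves one step at a time from the path to the backward recursion: the mean
of 1{`y` avoided up to time `m`} times `survival ω y j (X m)` depends only on `m + j`. Taking `j =
0` gives the claim. -/
lemma quenchedLaw_avoid (ω : Env) (x y : ℤ) (n : ℕ) :
    quenchedLaw ω x {X | ∀ k ≤ n, X k ≠ y} = survival ω y n x := by
  have hms : ∀ m : ℕ, MeasurableSet {Y : Finset.Iic m → ℤ | ∀ k, Y k ≠ y} := fun m => by
    rw [Set.ofPred_forall]
    exact MeasurableSet.iInter fun k => (measurableSet_eq_fun (by fun_prop) (by fun_prop)).compl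
  have hind : ∀ (m : ℕ) (X : ℕ → ℤ),
      {Y : Finset.Iic m → ℤ | ∀ k, Y k ≠ y}.indicator (1 : (Finset.Iic m → ℤ) → ℝ≥0∞) (Preorder.frestrictLe m X) =
        {X : ℕ → ℤ | ∀ k ≤ m, X k ≠ y}.indicator 1 X := by
    intro m X
    by_cases hX : ∀ k ≤ m, X k ≠ y
    · rw [Set.indicator_of_mem, Set.indicator_of_mem]
      · rfl
      · exact hX
      · rintro ⟨k, hk⟩
        exact hX k (Finset.mem_Iic.1 hk)
    · rw [Set.indicator_of_notMem, Set.indicator_of_notMem]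
      · exact hX
      · exact fun hc => hX fun k hk => hc ⟨k, Finset.mem_Iic.2 hk⟩
  have key : ∀ m j : ℕ, ∫⁻ X, {X : ℕ → ℤ | ∀ k ≤ m, X k ≠ y}.indicator 1 X *
      survival ω y j (X m) ∂quenchedLaw ω x = survival ω y (m + j) x := by
    intro m
    induction m with
    | zero =>
      intro j
      have : ∀ᵐ X ∂quenchedLaw ω x, {X : ℕ → ℤ | ∀ k ≤ 0, X k ≠ y}.indicator 1 X *
          survival ω y j (X 0) = survival ω y j x := by
        filter_upwards [quenchedLaw_ae_zero ω x] with X hX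
        rw [hX]
        by_cases h : x = y
        · have : survival ω y j x = 0 := by cases j <;> simp [survival, h]
          simp [this]
        · rw [Set.indicator_of_mem]
          · simp
          · intro k hk
            rw [Nat.le_zero.1 hk, hX]
            exact h
      rw [lintegral_congr_ae this]
      have : IsProbabilityMeasure (quenchedLaw ω x) := by unfold quenchedLaw; infer_instance
      simp
    | succ m ih =>
      intro j
      rw [show m + 1 + j = m + (j + 1) by ring, ← ih (j + 1)]
      have e1 : ∀ X : ℕ → ℤ, {X : ℕ → ℤ | ∀ k ≤ m + 1, X k ≠ y}.indicator 1 X *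
          survival ω y j (X (m + 1)) =
          {Y : Finset.Iic m → ℤ | ∀ k, Y k ≠ y}.indicator 1 (Preorder.frestrictLe m X) *
            survival ω y j (X (m + 1)) := by
        intro X
        rw [hind]
        by_cases h : X (m + 1) = y
        · have : survival ω y j (X (m + 1)) = 0 := by cases j <;> simp [survival, h]
          simp [this]
        · congr 1
          by_cases hX : ∀ k ≤ m, X k ≠ y
          · have hX' : ∀ k ≤ m + 1, X k ≠ y := fun k hk => by
              rcases Nat.le_succ_iff.1 hk with hk | rfl
              · exact hX k hk
              · exact h
            rw [Set.indicator_of_mem (by exact hX'), Set.indicator_of_mem (by exact hX)]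
          · rw [Set.indicator_of_notMem, Set.indicator_of_notMem]
            · exact hX
            · exact fun hc => hX fun k hk => hc k (hk.trans (Nat.le_succ m))
      simp_rw [e1]
      rw [lintegral_quenchedLaw_succ ω x m _ (hms m)]
      refine lintegral_congr fun X => ?_
      rw [hind]
      by_cases hX : ∀ k ≤ m, X k ≠ y
      · rw [survival, if_neg (hX m le_rfl)]
      · rw [Set.indicator_of_notMem]
        · simp
        · exact hX
  rw [← lintegral_indicator_one (measurableSet_avoid y n),
    show survival ω y n x = survival ω y (n + 0) x from rfl, ← key n 0]
  refine lintegral_congr fun X => ?_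
  by_cases hX : ∀ k ≤ n, X k ≠ y
  · simp [survival, hX n le_rfl]
  · have : X ∉ {X : ℕ → ℤ | ∀ k ≤ n, X k ≠ y} := hX
    rw [Set.indicator_of_notMem this, zero_mul]

/-- The tail-sum formula, holding pathwise and also when `y` is never hit, so that the mean hitting
time is the sum of the survival probabilities. -/
lemma hitTime_eq_tsum (y : ℤ) (X : ℕ → ℤ) :
    hitTime y X = ∑' n : ℕ, {X : ℕ → ℤ | ∀ k ≤ n, X k ≠ y}.indicator 1 X := by
  classical
  by_cases h : ∃ n, X n = y
  · have h1 : hitTime y X = (Nat.find h : ℝ≥0∞) := by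
      refine le_antisymm (iInf₂_le (Nat.find h) (Nat.find_spec h)) (le_iInf₂ fun n hn => ?_)
      exact_mod_cast Nat.find_min' h hn
    have h2 : ∀ n, {X : ℕ → ℤ | ∀ k ≤ n, X k ≠ y}.indicator (1 : (ℕ → ℤ) → ℝ≥0∞) X =
        if n < Nat.find h then 1 else 0 := by
      intro n
      split_ifs with hn
      · rw [Set.indicator_of_mem]
        · rfl
        · exact fun k hk => Nat.find_min h (hk.trans_lt hn)
      · rw [Set.indicator_of_notMem]
        exact fun hc => hc _ (not_lt.1 hn) (Nat.find_spec h)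
    simp_rw [h1, h2]
    rw [tsum_eq_sum (s := Finset.range (Nat.find h))]
    · rw [Finset.sum_congr rfl fun n hn => if_pos (Finset.mem_range.1 hn)]
      simp
    · intro n hn
      rw [if_neg (by simpa using hn)]
  · push Not at h
    have h1 : hitTime y X = ∞ := by simp [hitTime, h]
    have h2 : ∀ n, {X : ℕ → ℤ | ∀ k ≤ n, X k ≠ y}.indicator (1 : (ℕ → ℤ) → ℝ≥0∞) X = 1 := by
      intro n
      rw [Set.indicator_of_mem]
      · rfl
      · exact fun k _ => h k
    simp_rw [h1, h2]
    rw [ENNReal.tsum_const_eq_top_of_ne_zero one_ne_zero]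

lemma lintegral_hitTime (ω : Env) (x y : ℤ) :
    ∫⁻ X, hitTime y X ∂quenchedLaw ω x = ∑' n, survival ω y n x := by
  simp_rw [hitTime_eq_tsum]
  rw [lintegral_tsum]
  · refine tsum_congr fun n => ?_
    rw [lintegral_indicator_one (measurableSet_avoid y n), quenchedLaw_avoid]
  · exact fun n => (measurable_one.indicator (measurableSet_avoid y n)).aemeasurable

/-! ### The explicit formula for mean hitting times to the right -/

lemma ofReal_mul_odds {p : Set.Icc (0 : ℝ) 1} (hp : 0 < (p : ℝ)) :
    ENNReal.ofReal (p : ℝ) * odds p = ENNReal.ofReal (1 - (p : ℝ)) :=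
  ENNReal.mul_div_cancel (by simpa using hp) ENNReal.ofReal_ne_top

lemma survival_self (ω : Env) (y : ℤ) (n : ℕ) : survival ω y n y = 0 := by
  cases n <;> simp [survival]

lemma survival_succ_of_ne (ω : Env) {x y : ℤ} (h : x ≠ y) (n : ℕ) :
    survival ω y (n + 1) x = ENNReal.ofReal (ω x : ℝ) * survival ω y n (x + 1) +
      ENNReal.ofReal (1 - (ω x : ℝ)) * survival ω y n (x - 1) := by
  rw [survival, if_neg h]

lemma survival_succ_le (ω : Env) (y : ℤ) (n : ℕ) (x : ℤ) :
    survival ω y (n + 1) x ≤ survival ω y n x := by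
  induction n generalizing x with
  | zero =>
    by_cases h : x = y
    · simp [survival, h]
    · have h1 : ∀ z, survival ω y 0 z ≤ 1 := fun z => by
        simp only [survival]; split_ifs <;> simp
      rw [survival_succ_of_ne ω h]
      calc ENNReal.ofReal (ω x : ℝ) * survival ω y 0 (x + 1) +
            ENNReal.ofReal (1 - (ω x : ℝ)) * survival ω y 0 (x - 1)
          ≤ ENNReal.ofReal (ω x : ℝ) * 1 + ENNReal.ofReal (1 - (ω x : ℝ)) * 1 := by
            gcongr <;> exact h1 _
        _ = survival ω y 0 x := by
            rw [mul_one, mul_one, ofReal_add_ofReal_one_sub, survival, if_neg h]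
  | succ n ih =>
    rw [survival]
    nth_rw 3 [survival]
    split_ifs
    · rfl
    · gcongr <;> exact ih _

/-- A walk left of `y` must pass through `x + 1`, and reaching it takes at least one step. The two
inequalities feed each other in the induction: the second at `n` gives monotonicity in `x` at `n +
1`, and averaging monotonicity over the two neighbours of `x` gives the second at `n + 1`. -/
lemma survival_add_one_le (ω : Env) (y : ℤ) (n : ℕ) (x : ℤ) (hx : x < y) :
    survival ω y n (x + 1) ≤ survival ω y n x ∧
      survival ω y n (x + 1) ≤ survival ω y (n + 1) x := by
  induction n generalizing x with
  | zero =>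
    have h1 : survival ω y 0 (x + 1) ≤ survival ω y 0 x := by
      simp only [survival, if_neg hx.ne]
      split_ifs <;> simp
    refine ⟨h1, ?_⟩
    rw [survival_succ_of_ne ω hx.ne]
    calc survival ω y 0 (x + 1) = (ENNReal.ofReal (ω x : ℝ) + ENNReal.ofReal (1 - (ω x : ℝ))) *
          survival ω y 0 (x + 1) := by rw [ofReal_add_ofReal_one_sub, one_mul]
      _ ≤ _ := by
        rw [add_mul]
        gcongr
        simp only [survival]
        rw [if_neg (show x - 1 ≠ y by omega)]
        split_ifs <;> simp
  | succ n ih =>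
    have h1 : survival ω y (n + 1) (x + 1) ≤ survival ω y (n + 1) x :=
      (survival_succ_le ω y n (x + 1)).trans (ih x hx).2
    have h1' : survival ω y (n + 1) x ≤ survival ω y (n + 1) (x - 1) := by
      have h := ih (x - 1) (by omega)
      rw [sub_add_cancel] at h
      exact (survival_succ_le ω y n x).trans h.2
    refine ⟨h1, ?_⟩
    rw [survival_succ_of_ne ω hx.ne]
    calc survival ω y (n + 1) (x + 1) =
          (ENNReal.ofReal (ω x : ℝ) + ENNReal.ofReal (1 - (ω x : ℝ))) *
          survival ω y (n + 1) (x + 1) := by rw [ofReal_add_ofReal_one_sub, one_mul]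
      _ ≤ _ := by
        rw [add_mul]
        gcongr
        exact h1.trans h1'

/-- The candidate for `E_ω^x [T_y]`, as a function of `y - x`. -/
def meanHit (ω : Env) (y : ℤ) (k : ℕ) : ℝ≥0∞ :=
  ∑ j ∈ Finset.range k, (1 + 2 * pastSum (past ω (y - j)))

lemma tsum_survival (ω : Env) (y x : ℤ) (hx : x < y) :
    ∑' n, survival ω y n x = 1 + (ENNReal.ofReal (ω x : ℝ) * ∑' n, survival ω y n (x + 1) +
      ENNReal.ofReal (1 - (ω x : ℝ)) * ∑' n, survival ω y n (x - 1)) := by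
  rw [tsum_eq_zero_add' ENNReal.summable, ← ENNReal.tsum_mul_left, ← ENNReal.tsum_mul_left,
    ← ENNReal.tsum_add]
  simp [survival, hx.ne]

/-- The candidate is a nonnegative solution of `h(x) = 1 + p h(x+1) + q h(x-1)`, `h(y) = 0`, and the
mean hitting time is the least such solution: its truncations stay below by induction on `N`. -/
lemma sum_survival_le (ω : Env) (hω : ∀ x, 0 < (ω x : ℝ)) (y : ℤ) (N k : ℕ) :
    ∑ n ∈ Finset.range N, survival ω y n (y - k) ≤ meanHit ω y k := by
  induction N generalizing k with
  | zero => simp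
  | succ N ih =>
    cases k with
    | zero => simp [survival_self]
    | succ k =>
      have hne : y - (k + 1 : ℕ) ≠ y := by push_cast; omega
      set x := y - (k + 1 : ℕ) with hx
      have hxs : x + 1 = y - k := by rw [hx]; push_cast; ring
      have hxp : x - 1 = y - (k + 2 : ℕ) := by rw [hx]; push_cast; ring
      rw [Finset.sum_range_succ']
      simp only [survival, if_neg hne, Finset.sum_add_distrib, ← Finset.mul_sum]
      have h1 := ih k
      have h2 := ih (k + 2)
      rw [← hxs] at h1
      rw [← hxp] at h2
      set p := ENNReal.ofReal (ω x : ℝ)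
      set q := ENNReal.ofReal (1 - (ω x : ℝ))
      have hpq : p + q = 1 := ofReal_add_ofReal_one_sub _
      have hpo : p * odds (ω x) = q := ofReal_mul_odds (hω x)
      have e1 : meanHit ω y (k + 1) = meanHit ω y k + (1 + 2 * pastSum (past ω (x + 1))) := by
        rw [meanHit, Finset.sum_range_succ, hxs]; rfl
      have e2 : meanHit ω y (k + 2) = meanHit ω y (k + 1) + (1 + 2 * pastSum (past ω x)) := by
        rw [meanHit, Finset.sum_range_succ]; rfl
      calc p * ∑ i ∈ Finset.range N, survival ω y i (x + 1) +
            q * ∑ i ∈ Finset.range N, survival ω y i (x - 1) + 1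
          ≤ p * meanHit ω y k + q * meanHit ω y (k + 2) + 1 := by gcongr
        _ = p * meanHit ω y k + q * meanHit ω y (k + 1) +
            (q * (1 + 2 * pastSum (past ω x)) + (p + q)) := by rw [e2, hpq]; ring
        -- With `q = p ρ_x`, the constant terms add up to `p (1 + 2 ρ_x (1 + W_x)) = p (1 + 2
        -- W_{x+1})`, the last increment of the candidate.
        _ = p * meanHit ω y k + q * meanHit ω y (k + 1) +
            (p + 2 * (p * odds (ω x)) * (1 + pastSum (past ω x))) := by rw [hpo]; ring
        _ = p * (meanHit ω y k + (1 + 2 * pastSum (past ω (x + 1)))) +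
            q * meanHit ω y (k + 1) := by rw [pastSum_past_succ]; ring
        _ = meanHit ω y (k + 1) := by rw [← e1, ← add_mul, hpq, one_mul]

lemma tsum_survival_le (ω : Env) (hω : ∀ x, 0 < (ω x : ℝ)) (y : ℤ) (k : ℕ) :
    ∑' n, survival ω y n (y - k) ≤ meanHit ω y k :=
  ENNReal.tsum_le_of_sum_range_le fun N => sum_survival_le ω hω y N k

/-- The increments `D(x) = H(x) - H(x+1)` of the true mean `H` satisfy `D(x) = 1 + ρ_x + ρ_x
D(x-1)`. Starting from the trivial bound `D ≥ 1` and iterating `m` times produces the first `m`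
terms of the series. -/
lemma le_tsum_survival (ω : Env) (hω : ∀ x, 0 < (ω x : ℝ))
    (hW : ∀ x, pastSum (past ω x) ≠ ∞) (y : ℤ) (m : ℕ) (x : ℤ) (hx : x < y) :
    ∑' n, survival ω y n (x + 1) +
      (1 + 2 * ∑ k ∈ Finset.range m, prefixProd (past ω (x + 1)) (k + 1)) ≤
        ∑' n, survival ω y n x := by
  induction m generalizing x with
  | zero =>
    rw [Finset.sum_range_zero, mul_zero, add_zero]
    nth_rw 2 [tsum_eq_zero_add' ENNReal.summable]
    rw [show survival ω y 0 x = 1 by simp [survival, hx.ne], add_comm]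
    gcongr
    exact (survival_add_one_le ω y _ x hx).2
  | succ m ih =>
    have h := ih (x - 1) (by omega)
    rw [sub_add_cancel] at h
    -- The upper bound makes `H` finite, which is needed to cancel `q * H` at the end.
    have hfin : ∑' n, survival ω y n x ≠ ∞ := by
      have := tsum_survival_le ω hω y (y - x).toNat
      rw [show y - ((y - x).toNat : ℤ) = x by omega] at this
      refine ne_top_of_le_ne_top ?_ this
      rw [meanHit, ENNReal.sum_ne_top]
      exact fun j _ => by finiteness [hW (y - j)]
    have hrec := tsum_survival ω y x hx
    set p := ENNReal.ofReal (ω x : ℝ) with hp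
    set q := ENNReal.ofReal (1 - (ω x : ℝ)) with hq
    have hpq : p + q = 1 := ofReal_add_ofReal_one_sub _
    have hpo : p * odds (ω x) = q := ofReal_mul_odds (hω x)
    have hp0 : p ≠ 0 := by simpa [hp] using hω x
    have hpt : p ≠ ∞ := ENNReal.ofReal_ne_top
    have hqt : q ≠ ∞ := ENNReal.ofReal_ne_top
    set H := ∑' n, survival ω y n x
    set H1 := ∑' n, survival ω y n (x + 1)
    set T := ∑ k ∈ Finset.range m, prefixProd (past ω x) (k + 1)
    have e : ∑ k ∈ Finset.range (m + 1), prefixProd (past ω (x + 1)) (k + 1) =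
        odds (ω x) * (1 + T) := by
      simp only [prefixProd_past_succ, ← Finset.mul_sum]
      rw [Finset.sum_range_succ', prefixProd_zero, add_comm 1]
    have h1 : 1 + (p * H1 + q * (H + (1 + 2 * T))) ≤ H :=
      le_of_le_of_eq (by gcongr) hrec.symm
    have h2 : q * H + p * (H1 + (1 + 2 * (odds (ω x) * (1 + T)))) ≤ q * H + p * H := by
      calc _ = (p + q) + (p * H1 + q * (H + (1 + 2 * T))) := by
            rw [show q * H + p * (H1 + (1 + 2 * (odds (ω x) * (1 + T)))) =
              q * H + p * H1 + p + 2 * (p * odds (ω x)) * (1 + T) by ring, hpo]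
            ring
        _ ≤ H := by rw [hpq]; exact h1
        _ = q * H + p * H := by rw [← add_mul, add_comm q, hpq, one_mul]
    rw [e]
    rw [ENNReal.add_le_add_iff_left (by finiteness)] at h2
    exact (ENNReal.mul_le_mul_iff_right hp0 hpt).1 h2

/-- The quenched mean of a hitting time to the right. -/
theorem lintegral_hitTime_eq (ω : Env) (hω : ∀ x, 0 < (ω x : ℝ))
    (hW : ∀ x, pastSum (past ω x) ≠ ∞) (y : ℤ) (k : ℕ) :
    ∫⁻ X, hitTime y X ∂quenchedLaw ω (y - k) = meanHit ω y k := by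
  rw [lintegral_hitTime]
  refine le_antisymm (tsum_survival_le ω hω y k) ?_
  induction k with
  | zero => simp [meanHit]
  | succ k ih =>
    have hxs : y - (k + 1 : ℕ) + 1 = y - k := by push_cast; ring
    rw [meanHit, Finset.sum_range_succ, pastSum, ENNReal.tsum_eq_iSup_nat, ENNReal.mul_iSup,
      ENNReal.add_iSup, ENNReal.add_iSup]
    refine iSup_le fun m => ?_
    have h := le_tsum_survival ω hω hW y m (y - (k + 1 : ℕ)) (by push_cast; omega)
    rw [hxs] at h
    exact (add_le_add_left ih _).trans h

/-- The mean crossing time of the block starting at `x`, in terms of the affine recursion. -/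
theorem lintegral_hitTime_eq_accum (ω : Env) (hω : ∀ x, 0 < (ω x : ℝ))
    (hW : ∀ x, pastSum (past ω x) ≠ ∞) (x : ℤ) (k : ℕ) :
    ∫⁻ X, hitTime (x + k) X ∂quenchedLaw ω x =
      ∑ j ∈ Finset.range k, (1 + 2 * accum (pastSum (past ω x)) (future ω x) (j + 1)) := by
  have h := lintegral_hitTime_eq ω hω hW (x + k) k
  rw [add_sub_cancel_right] at h
  rw [h, meanHit, ← Finset.sum_range_reflect]
  refine Finset.sum_congr rfl fun j hj => ?_
  rw [accum_pastSum]
  have := Finset.mem_range.1 hj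
  congr 4
  push_cast
  omega

/-! ### Product measures -/

lemma measurePreserving_sumElim {X κ₁ κ₂ : Type*} [MeasurableSpace X] (μ : Measure X)
    [IsProbabilityMeasure μ] :
    MeasurePreserving (fun z : (κ₁ → X) × (κ₂ → X) => (Sum.elim z.1 z.2 : κ₁ ⊕ κ₂ → X))
      ((Measure.infinitePi fun _ : κ₁ => μ).prod (Measure.infinitePi fun _ : κ₂ => μ))
      (Measure.infinitePi fun _ : κ₁ ⊕ κ₂ => μ) := by
  have hm : Measurable (fun z : (κ₁ → X) × (κ₂ → X) => (Sum.elim z.1 z.2 : κ₁ ⊕ κ₂ → X)) := by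
    refine measurable_pi_lambda _ fun i => ?_
    cases i
    · exact (measurable_pi_apply _).comp measurable_fst
    · exact (measurable_pi_apply _).comp measurable_snd
  refine ⟨hm, Measure.eq_infinitePi _ fun s t ht => ?_⟩
  rw [Measure.map_apply hm (.pi s.countable_toSet fun i _ => ht i)]
  have : (fun z : (κ₁ → X) × (κ₂ → X) => (Sum.elim z.1 z.2 : κ₁ ⊕ κ₂ → X)) ⁻¹' ((s : Set _).pi t) =
      (Set.pi (s.toLeft : Set κ₁) fun i => t (.inl i)) ×ˢ
        (Set.pi (s.toRight : Set κ₂) fun i => t (.inr i)) := by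
    ext z
    simp [Set.mem_pi]
  rw [this, Measure.prod_prod, Measure.infinitePi_pi _ fun i _ => ht _,
    Measure.infinitePi_pi _ fun i _ => ht _]
  nth_rw 3 [← Finset.toLeft_disjSum_toRight (u := s)]
  rw [Finset.prod_disjSum]

/-- One source for both independence facts used below: the split of `ℤ` into past and future, and
the replacement of the tail of a sequence by a fresh copy. -/
lemma measurePreserving_glue {X ι κ₁ κ₂ : Type*} [MeasurableSpace X] (μ : Measure X)
    [IsProbabilityMeasure μ] {e : ι → κ₁ ⊕ κ₂} (he : Function.Injective e) :
    MeasurePreserving (fun (z : (κ₁ → X) × (κ₂ → X)) i => (Sum.elim z.1 z.2 (e i) : X))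
      ((Measure.infinitePi fun _ : κ₁ => μ).prod (Measure.infinitePi fun _ : κ₂ => μ))
      (Measure.infinitePi fun _ : ι => μ) :=
  MeasurePreserving.comp (g := fun (y : κ₁ ⊕ κ₂ → X) i => y (e i))
    ⟨by fun_prop, Measure.map_infinitePi_infinitePi_of_inj he⟩ (measurePreserving_sumElim μ)

/-- The law of a one-sided i.i.d. environment. -/
def seqLaw (μ : Measure (Set.Icc (0 : ℝ) 1)) : Measure (ℕ → Set.Icc (0 : ℝ) 1) :=
  Measure.infinitePi fun _ : ℕ => μ

instance (μ : Measure (Set.Icc (0 : ℝ) 1)) [IsProbabilityMeasure μ] :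
    IsProbabilityMeasure (seqLaw μ) := by unfold seqLaw; infer_instance

instance (μ : Measure (Set.Icc (0 : ℝ) 1)) [IsProbabilityMeasure μ] :
    IsProbabilityMeasure (envLaw μ) := by unfold envLaw; infer_instance

/-- The first `m` terms of `z.1`, followed by `z.2`. -/
def splice (m : ℕ) (z : (ℕ → Set.Icc (0 : ℝ) 1) × (ℕ → Set.Icc (0 : ℝ) 1)) :
    ℕ → Set.Icc (0 : ℝ) 1 := fun i => if i < m then z.1 i else z.2 (i - m)

/-- The sequence without its first `m` terms. -/
def dropSeq (m : ℕ) (η : ℕ → Set.Icc (0 : ℝ) 1) : ℕ → Set.Icc (0 : ℝ) 1 := fun i => η (m + i)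

@[simp] lemma dropSeq_splice (m : ℕ) (z : (ℕ → Set.Icc (0 : ℝ) 1) × (ℕ → Set.Icc (0 : ℝ) 1)) :
    dropSeq m (splice m z) = z.2 := by
  ext i
  simp [dropSeq, splice]

lemma splice_of_lt {m i : ℕ} (h : i < m)
    (z : (ℕ → Set.Icc (0 : ℝ) 1) × (ℕ → Set.Icc (0 : ℝ) 1)) : splice m z i = z.1 i := if_pos h

lemma measurePreserving_splice (μ : Measure (Set.Icc (0 : ℝ) 1)) [IsProbabilityMeasure μ] (m : ℕ) :
    MeasurePreserving (splice m) ((seqLaw μ).prod (seqLaw μ)) (seqLaw μ) := by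
  have he : Function.Injective
      (fun i : ℕ => if i < m then (Sum.inl i : ℕ ⊕ ℕ) else Sum.inr (i - m)) := by
    intro i j h
    simp only at h
    split_ifs at h <;> simp at h <;> omega
  have h := measurePreserving_glue μ he
  have heq : (fun (z : (ℕ → Set.Icc (0 : ℝ) 1) × (ℕ → Set.Icc (0 : ℝ) 1)) i =>
      (Sum.elim z.1 z.2 (if i < m then (Sum.inl i : ℕ ⊕ ℕ) else Sum.inr (i - m)) :
        Set.Icc (0 : ℝ) 1)) = splice m := by
    ext z i
    simp only [splice]
    split_ifs <;> rfl
  rw [heq] at h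
  exact h

lemma measurePreserving_past_future (μ : Measure (Set.Icc (0 : ℝ) 1)) [IsProbabilityMeasure μ]
    (y : ℤ) : MeasurePreserving (fun ω : Env => (past ω y, future ω y)) (envLaw μ)
      ((seqLaw μ).prod (seqLaw μ)) := by
  let e : ℤ → ℕ ⊕ ℕ := fun x => if y ≤ x then .inr (x - y).toNat else .inl (y - 1 - x).toNat
  have he : Function.Injective e := by
    intro i j h
    simp only [e] at h
    split_ifs at h <;> simp at h <;> omega
  have hg := measurePreserving_glue μ he
  have hm : Measurable (fun ω : Env => (past ω y, future ω y)) := by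
    unfold past future; fun_prop
  refine ⟨hm, ?_⟩
  rw [envLaw, ← hg.map_eq, Measure.map_map hm hg.measurable]
  have : (fun ω : Env => (past ω y, future ω y)) ∘
      (fun (z : (ℕ → Set.Icc (0 : ℝ) 1) × (ℕ → Set.Icc (0 : ℝ) 1)) i =>
        (Sum.elim z.1 z.2 (e i) : Set.Icc (0 : ℝ) 1)) = id := by
    ext z i
    · have h : ¬ y ≤ y - 1 - (i : ℤ) := by omega
      simp [past, e, h]
    · simp [future, e]
  rw [this, Measure.map_id]
  rfl

/-- Translation of the environment. -/
def shift (m : ℤ) (ω : Env) : Env := fun x => ω (x + m)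

lemma measurePreserving_shift (μ : Measure (Set.Icc (0 : ℝ) 1)) [IsProbabilityMeasure μ] (m : ℤ) :
    MeasurePreserving (shift m) (envLaw μ) (envLaw μ) :=
  ⟨by unfold shift; fun_prop,
    Measure.map_infinitePi_infinitePi_of_inj (P := fun _ : ℤ => μ) (add_left_injective m)⟩

/-! ### Measurability -/

@[fun_prop] lemma measurable_odds : Measurable odds := by unfold odds; fun_prop

@[fun_prop] lemma measurable_prefixProd (k : ℕ) : Measurable fun η => prefixProd η k := by
  unfold prefixProd; fun_prop

@[fun_prop] lemma measurable_accum (k : ℕ) :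
    Measurable fun z : ℝ≥0∞ × (ℕ → Set.Icc (0 : ℝ) 1) => accum z.1 z.2 k := by
  induction k with
  | zero => exact measurable_fst
  | succ k ih => unfold accum; fun_prop

@[fun_prop] lemma measurable_pastSum : Measurable pastSum := by
  unfold pastSum; exact Measurable.tsum fun k => by fun_prop

@[fun_prop] lemma measurable_past (y : ℤ) : Measurable fun ω => past ω y := by
  unfold past; fun_prop

@[fun_prop] lemma measurable_future (y : ℤ) : Measurable fun ω => future ω y := by
  unfold future; fun_prop

@[fun_prop] lemma measurable_dropSeq (m : ℕ) : Measurable (dropSeq m) := by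
  unfold dropSeq; fun_prop

/-! ### The first descent below the starting level -/

/-- The length of the first block of a one-sided environment. -/
def firstDescent (η : ℕ → Set.Icc (0 : ℝ) 1) : ℕ := sInf {k | 0 < k ∧ prefixProd η k < 1}

/-- The value `0` is the default `sInf ∅`, so positivity of `firstDescent` says exactly that the
environment does descend. -/
lemma firstDescent_spec {η : ℕ → Set.Icc (0 : ℝ) 1} (h : 0 < firstDescent η) :
    prefixProd η (firstDescent η) < 1 :=
  (Nat.sInf_mem (Nat.nonempty_of_pos_sInf h)).2

lemma one_le_prefixProd {η : ℕ → Set.Icc (0 : ℝ) 1} {k : ℕ} (h : k < firstDescent η) :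
    1 ≤ prefixProd η k := by
  rcases Nat.eq_zero_or_pos k with rfl | hk
  · simp
  · by_contra hc
    exact Nat.notMem_of_lt_sInf h ⟨hk, not_le.1 hc⟩

lemma firstDescent_eq_iff {η : ℕ → Set.Icc (0 : ℝ) 1} {m : ℕ} (hm : 0 < m) :
    firstDescent η = m ↔ prefixProd η m < 1 ∧ ∀ k < m, 1 ≤ prefixProd η k := by
  constructor
  · rintro rfl
    exact ⟨firstDescent_spec hm, fun k hk => one_le_prefixProd hk⟩
  · rintro ⟨h1, h2⟩
    refine le_antisymm (Nat.sInf_le ⟨hm, h1⟩) ?_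
    refine le_csInf ⟨m, hm, h1⟩ fun k hk => ?_
    by_contra hc
    exact (h2 k (not_le.1 hc)).not_gt hk.2

lemma prefixProd_congr {η η' : ℕ → Set.Icc (0 : ℝ) 1} {k : ℕ} (h : ∀ i < k, η i = η' i) :
    prefixProd η k = prefixProd η' k :=
  Finset.prod_congr rfl fun i hi => by rw [h i (Finset.mem_range.1 hi)]

lemma accum_congr {η η' : ℕ → Set.Icc (0 : ℝ) 1} (w : ℝ≥0∞) {k : ℕ} (h : ∀ i < k, η i = η' i) :
    accum w η k = accum w η' k := by
  induction k with
  | zero => rfl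
  | succ k ih =>
    rw [accum, accum, ih fun i hi => h i (hi.trans (Nat.lt_succ_self k)), h k (Nat.lt_succ_self k)]

/-- The block length is a stopping time. -/
lemma firstDescent_congr {η η' : ℕ → Set.Icc (0 : ℝ) 1} {m : ℕ} (hm : 0 < m)
    (h : ∀ i < m, η i = η' i) : firstDescent η = m ↔ firstDescent η' = m := by
  rw [firstDescent_eq_iff hm, firstDescent_eq_iff hm, prefixProd_congr h]
  refine and_congr_right fun _ => forall₂_congr fun k hk => ?_
  rw [prefixProd_congr fun i hi => h i (hi.trans hk)]

@[fun_prop] lemma measurable_firstDescent : Measurable firstDescent := by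
  have h : ∀ m, 0 < m → MeasurableSet (firstDescent ⁻¹' {m}) := fun m hm => by
    have : firstDescent ⁻¹' {m} = {η | prefixProd η m < 1} ∩
        ⋂ k, ⋂ (_ : k < m), {η | 1 ≤ prefixProd η k} := by
      ext η
      simp [firstDescent_eq_iff hm]
    rw [this]
    exact (measurableSet_lt (by fun_prop) (by fun_prop)).inter
      (MeasurableSet.iInter fun k => MeasurableSet.iInter fun _ =>
        measurableSet_le (by fun_prop) (by fun_prop))
  refine measurable_to_countable' fun m => ?_
  rcases Nat.eq_zero_or_pos m with rfl | hm
  · have : firstDescent ⁻¹' {0} = ⋂ m, ⋂ (_ : 0 < m), (firstDescent ⁻¹' {m})ᶜ := by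
      ext η
      simp only [Set.mem_preimage, Set.mem_singleton_iff, Set.mem_iInter, Set.mem_compl_iff]
      exact ⟨fun h m hm => by omega, fun h => by
        by_contra hc
        exact h _ (Nat.pos_of_ne_zero hc) rfl⟩
    rw [this]
    exact MeasurableSet.iInter fun k => MeasurableSet.iInter fun hk => (h k hk).compl
  · exact h m hm

/-- The strong Markov property of an i.i.d. sequence at the end of the first block. -/
theorem lintegral_dropSeq_firstDescent (μ : Measure (Set.Icc (0 : ℝ) 1)) [IsProbabilityMeasure μ]
    (hpos : ∀ᵐ η ∂seqLaw μ, 0 < firstDescent η)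
    {F : (ℕ → Set.Icc (0 : ℝ) 1) → (ℕ → Set.Icc (0 : ℝ) 1) → ℝ≥0∞}
    (hF : Measurable (Function.uncurry F))
    (hdep : ∀ η η', 0 < firstDescent η → (∀ i < firstDescent η, η i = η' i) → F η = F η') :
    ∫⁻ η, F η (dropSeq (firstDescent η) η) ∂seqLaw μ =
      ∫⁻ η, ∫⁻ η', F η η' ∂seqLaw μ ∂seqLaw μ := by
  have hms : ∀ m, MeasurableSet {η | firstDescent η = m} := fun m =>
    measurableSet_eq_fun (by fun_prop) (by fun_prop)
  have hsplit : ∀ (f : (ℕ → Set.Icc (0 : ℝ) 1) → ℕ → ℝ≥0∞), (∀ m, Measurable fun η => f η m) →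
      ∫⁻ η, f η (firstDescent η) ∂seqLaw μ =
        ∑' m : ℕ, ∫⁻ η, {η | firstDescent η = m + 1}.indicator (fun η => f η (m + 1)) η
          ∂seqLaw μ := by
    intro f hf
    rw [← lintegral_tsum fun m => ((hf (m + 1)).indicator (hms (m + 1))).aemeasurable]
    refine lintegral_congr_ae ?_
    filter_upwards [hpos] with η hη
    obtain ⟨m, hm⟩ := Nat.exists_eq_succ_of_ne_zero hη.ne'
    rw [tsum_eq_single m]
    · rw [Set.indicator_of_mem (by exact hm), hm]
    · intro m' hm'
      rw [Set.indicator_of_notMem]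
      intro hc
      exact hm' (by have : firstDescent η = m' + 1 := hc; omega)
  have hF1 : ∀ m, Measurable fun η => F η (dropSeq m η) := fun m =>
    hF.comp (measurable_id.prodMk (measurable_dropSeq m))
  have hF2 : Measurable fun η => ∫⁻ η', F η η' ∂seqLaw μ := hF.lintegral_prod_right'
  rw [hsplit (fun η m => F η (dropSeq m η)) hF1,
    hsplit (fun η _ => ∫⁻ η', F η η' ∂seqLaw μ) fun _ => hF2]
  refine tsum_congr fun m => ?_
  -- On the event that the block has length `m + 1`, everything except the tail is determined by the
  -- first `m + 1` terms, so the tail may be resampled independently.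
  rw [← (measurePreserving_splice μ (m + 1)).lintegral_comp ((hF1 _).indicator (hms _)),
    lintegral_prod (fun z => {η | firstDescent η = m + 1}.indicator
      (fun η => F η (dropSeq (m + 1) η)) (splice (m + 1) z)) (((hF1 _).indicator (hms _)).comp
      (measurePreserving_splice μ (m + 1)).measurable).aemeasurable]
  refine lintegral_congr fun η => ?_
  have hc : ∀ η', ∀ i < m + 1, η i = splice (m + 1) (η, η') i := fun η' i hi =>
    (splice_of_lt hi (η, η')).symm
  by_cases h : firstDescent η = m + 1
  · rw [Set.indicator_of_mem (by exact h)]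
    refine lintegral_congr fun η' => ?_
    have h' : firstDescent (splice (m + 1) (η, η')) = m + 1 :=
      (firstDescent_congr (Nat.succ_pos m) (hc η')).1 h
    rw [Set.indicator_of_mem (by exact h'), dropSeq_splice,
      hdep η (splice (m + 1) (η, η')) (by omega) (by rw [h]; exact hc η')]
  · rw [Set.indicator_of_notMem (by exact h)]
    refine (lintegral_congr fun η' => ?_).trans lintegral_zero
    rw [Set.indicator_of_notMem]
    exact fun h' => h ((firstDescent_congr (Nat.succ_pos m) (hc η')).2 h')

/-! ### Consequences of the standing assumption -/

lemma prefixProd_add (η : ℕ → Set.Icc (0 : ℝ) 1) (m k : ℕ) :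
    prefixProd η (m + k) = prefixProd η m * prefixProd (dropSeq m η) k := by
  simp [prefixProd, Finset.prod_range_add, dropSeq]

lemma lintegral_prefixProd (μ : Measure (Set.Icc (0 : ℝ) 1)) [IsProbabilityMeasure μ] (k : ℕ) :
    ∫⁻ η, prefixProd η k ∂seqLaw μ = (∫⁻ p, odds p ∂μ) ^ k := by
  induction k with
  | zero => simp
  | succ k ih =>
    rw [← (measurePreserving_splice μ 1).lintegral_comp (measurable_prefixProd _)]
    have : ∀ z : (ℕ → Set.Icc (0 : ℝ) 1) × (ℕ → Set.Icc (0 : ℝ) 1),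
        prefixProd (splice 1 z) (k + 1) = odds (z.1 0) * prefixProd z.2 k := by
      intro z
      rw [add_comm, prefixProd_add, dropSeq_splice]
      simp [prefixProd, splice]
    simp_rw [this]
    rw [lintegral_prod_mul (f := fun η : ℕ → Set.Icc (0 : ℝ) 1 => odds (η 0))
      (g := fun η => prefixProd η k) 
      (measurable_odds.comp (measurable_pi_apply 0)).aemeasurable (by fun_prop), ih, pow_succ', seqLaw,
      (measurePreserving_eval_infinitePi (fun _ : ℕ => μ) 0).lintegral_comp measurable_odds]

/-- Off `t = 1`, the function `t ^ s` lies strictly above its tangent line at `1`. -/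
lemma mul_add_one_lt_rpow_add {s : ℝ} (hs : 1 < s) {t : ℝ} (ht : 0 ≤ t) (h1 : t ≠ 1) :
    s * t + 1 < t ^ s + s := by
  have := one_add_mul_self_lt_rpow_one_add (s := t - 1) (by linarith) (sub_ne_zero.2 h1) hs
  rw [add_sub_cancel] at this
  linarith

/-- Integrating the tangent-line inequality against `E[ρ_0 ^ s] = 1` gives `E[ρ_0] ≤ 1`. Equality
would force `ρ_0 = 1` almost surely, and then both parts of `log ρ_0` would have mean zero. -/
lemma lintegral_odds_lt_one {μ : Measure (Set.Icc (0 : ℝ) 1)} [IsProbabilityMeasure μ] {s : ℝ}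
    (h : BallisticAssumption μ s) : ∫⁻ p, odds p ∂μ < 1 := by
  obtain ⟨hs, hlog, hpow⟩ := h
  have hs0 : 0 < s := by linarith
  have key : ∀ a : ℝ≥0∞, a ≠ 1 → a ≠ ∞ →
      ENNReal.ofReal s * a + 1 < a ^ s + ENNReal.ofReal s := by
    intro a ha1 hat
    lift a to NNReal using hat
    rw [← ENNReal.ofReal_coe_nnreal, ENNReal.ofReal_rpow_of_nonneg (p := s) a.coe_nonneg hs0.le,
      ← ENNReal.ofReal_mul hs0.le, ← ENNReal.ofReal_one, ← ENNReal.ofReal_add (by positivity)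
      (by positivity), ← ENNReal.ofReal_add (by positivity) (by positivity),
      ENNReal.ofReal_lt_ofReal_iff (by positivity)]
    exact mul_add_one_lt_rpow_add hs a.2 (by exact_mod_cast ha1)
  have hle : ∀ a : ℝ≥0∞, ENNReal.ofReal s * a + 1 ≤ a ^ s + ENNReal.ofReal s := by
    intro a
    by_cases ha1 : a = 1
    · simp [ha1, add_comm]
    by_cases hat : a = ∞
    · simp [hat, hs0]
    · exact (key a ha1 hat).le
  have e1 : ∫⁻ p, (ENNReal.ofReal s * odds p + 1) ∂μ = ENNReal.ofReal s * ∫⁻ p, odds p ∂μ + 1 := by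
    rw [lintegral_add_right _ measurable_const, lintegral_const_mul _ measurable_odds]
    simp
  have e2 : ∫⁻ p, (odds p ^ s + ENNReal.ofReal s) ∂μ = 1 + ENNReal.ofReal s := by
    rw [lintegral_add_right _ measurable_const, hpow]
    simp
  have hs' : ENNReal.ofReal s ≠ 0 := by simpa using hs0
  have h1 : ∫⁻ p, odds p ∂μ ≤ 1 := by
    have := lintegral_mono (μ := μ) fun p => hle (odds p)
    rw [e1, e2, add_comm, ENNReal.add_le_add_iff_left ENNReal.one_ne_top] at this
    calc _ = (ENNReal.ofReal s)⁻¹ * (ENNReal.ofReal s * ∫⁻ p, odds p ∂μ) := by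
          rw [← mul_assoc, ENNReal.inv_mul_cancel hs' ENNReal.ofReal_ne_top, one_mul]
      _ ≤ (ENNReal.ofReal s)⁻¹ * ENNReal.ofReal s := by gcongr
      _ = 1 := ENNReal.inv_mul_cancel hs' ENNReal.ofReal_ne_top
  refine lt_of_le_of_ne h1 fun heq => ?_
  have hae : (fun p => ENNReal.ofReal s * odds p + 1) =ᵐ[μ]
      fun p => odds p ^ s + ENNReal.ofReal s := by
    refine ae_eq_of_ae_le_of_lintegral_le (Filter.Eventually.of_forall fun p => hle (odds p)) ?_
      (by fun_prop) ?_
    · rw [e1, heq]; finiteness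
    · rw [e1, e2, heq, mul_one, add_comm]
  have hfin : ∀ᵐ p ∂μ, odds p < ∞ := ae_lt_top measurable_odds (by rw [heq]; simp)
  have hone : ∀ᵐ p ∂μ, odds p = 1 := by
    filter_upwards [hae, hfin] with p hp hpt
    by_contra hc
    exact (key _ hc hpt.ne).ne hp
  have z1 : ∫⁻ p, (ENNReal.log (odds p)).toENNReal ∂μ = 0 := by
    rw [lintegral_congr_ae (g := fun _ => 0)]
    · simp
    · filter_upwards [hone] with p hp
      simp [hp]
  have z2 : ∫⁻ p, (-ENNReal.log (odds p)).toENNReal ∂μ = 0 := by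
    rw [lintegral_congr_ae (g := fun _ => 0)]
    · simp
    · filter_upwards [hone] with p hp
      simp [hp]
  rw [z1, z2] at hlog
  exact lt_irrefl _ hlog

/-! ### Ladder points of a two-sided environment -/

/-- The pasts seen from a ladder point. -/
def ladderPast : Set (ℕ → Set.Icc (0 : ℝ) 1) := {ζ | ∀ k, prefixProd ζ (k + 1) < 1}

lemma measurableSet_ladderPast : MeasurableSet ladderPast := by
  have : ladderPast = ⋂ k, {ζ | prefixProd ζ (k + 1) < 1} := by ext; simp [ladderPast]
  rw [this]
  exact MeasurableSet.iInter fun k => measurableSet_lt (by fun_prop) (by fun_prop)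

lemma dropSeq_past (ω : Env) (y : ℤ) (m : ℕ) : dropSeq m (past ω y) = past ω (y - m) := by
  ext i
  simp only [dropSeq, past]
  congr 2
  push_cast
  ring

lemma dropSeq_future (ω : Env) (y : ℤ) (m : ℕ) : dropSeq m (future ω y) = future ω (y + m) := by
  ext i
  simp only [dropSeq, future]
  congr 2
  push_cast
  ring

lemma past_shift (ω : Env) (m y : ℤ) : past (shift m ω) y = past ω (y + m) := by
  ext i
  simp only [past, shift]
  congr 2
  ring

lemma future_shift (ω : Env) (m y : ℤ) : future (shift m ω) y = future ω (y + m) := by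
  ext i
  simp only [future, shift]
  congr 2
  ring

lemma prefixProd_past_add (ω : Env) (x : ℤ) (m k : ℕ) :
    prefixProd (past ω (x + m)) (m + k) =
      prefixProd (future ω x) m * prefixProd (past ω x) k := by
  induction m with
  | zero => simp
  | succ m ih =>
    rw [Nat.cast_succ, ← add_assoc, Nat.add_right_comm, prefixProd_past_succ, ih, prefixProd_succ]
    simp only [future]
    ring

lemma prefixProd_past_eq_future (ω : Env) (x : ℤ) (m : ℕ) :
    prefixProd (past ω (x + m)) m = prefixProd (future ω x) m := by
  simpa using prefixProd_past_add ω x m 0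

/-- A product ending at the new point either starts inside the block, where the prefix it omits is
at least `1` while the whole block has product below `1`, or starts at or before `x`, where it is
the block product times a product that is at most `1`. -/
lemma mem_ladderPast_next {ω : Env} {x : ℤ} (h : past ω x ∈ ladderPast)
    (hm : 0 < firstDescent (future ω x)) :
    past ω (x + firstDescent (future ω x)) ∈ ladderPast := by
  set m := firstDescent (future ω x) with hmdef
  have hlt : prefixProd (future ω x) m < 1 := firstDescent_spec hm
  intro k
  rcases le_or_gt (k + 1) m with hk | hk
  · obtain ⟨j, hj⟩ := Nat.exists_eq_add_of_le' hk
    have e1 : x + (m : ℤ) = (x + j) + (k + 1 : ℕ) := by rw [hj]; push_cast; ring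
    rw [e1, prefixProd_past_eq_future]
    have e2 := prefixProd_add (future ω x) j (k + 1)
    rw [← hj, dropSeq_future] at e2
    have hj1 : 1 ≤ prefixProd (future ω x) j := one_le_prefixProd (by omega)
    calc _ = 1 * prefixProd (future ω (x + j)) (k + 1) := (one_mul _).symm
      _ ≤ _ := mul_le_mul_left hj1 _
      _ < 1 := by rw [← e2]; exact hlt
  · obtain ⟨j, hj⟩ := Nat.exists_eq_add_of_lt hk
    rw [hj, add_assoc, prefixProd_past_add]
    calc _ ≤ prefixProd (future ω x) m * 1 := by gcongr; exact (h j).le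
      _ < 1 := by rwa [mul_one]

/-- If there were two predecessors, the right one would be a ladder point strictly inside the block
of the left one, where the prefix products are still at least `1`. -/
lemma previous_ladder_unique {ω : Env} {z : ℤ} {m m' : ℕ} (hm : 0 < m) (hm' : 0 < m')
    (h : past ω (z - m) ∈ ladderPast ∧ firstDescent (future ω (z - m)) = m)
    (h' : past ω (z - m') ∈ ladderPast ∧ firstDescent (future ω (z - m')) = m') : m = m' := by
  wlog hlt : m' < m generalizing m m'
  · rcases lt_trichotomy m' m with h1 | h1 | h1
    · exact this hm hm' h h' h1
    · exact h1.symm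
    · exact (this hm' hm h' h h1).symm
  exfalso
  obtain ⟨j, hj⟩ := Nat.exists_eq_add_of_lt hlt
  have h1 := h'.1 j
  rw [show z - (m' : ℤ) = (z - m) + (j + 1 : ℕ) by rw [hj]; push_cast; ring,
    prefixProd_past_eq_future] at h1
  exact (one_le_prefixProd (by omega)).not_gt h1

/-- The nearest ladder point on the left works: if its block ended before `z`, that end would be a
nearer ladder point. -/
lemma exists_previous_ladder {ω : Env} {z : ℤ} (hz : past ω z ∈ ladderPast)
    (h : ∃ m : ℕ, 0 < m ∧ past ω (z - m) ∈ ladderPast) :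
    ∃ m : ℕ, 0 < m ∧ past ω (z - m) ∈ ladderPast ∧ firstDescent (future ω (z - m)) = m := by
  classical
  obtain ⟨m, hmdef⟩ : ∃ m, m = Nat.find h := ⟨_, rfl⟩
  obtain ⟨hm, hl⟩ := Nat.find_spec h
  rw [← hmdef] at hm hl
  refine ⟨m, hm, hl, (firstDescent_eq_iff hm).2 ⟨?_, ?_⟩⟩
  · rw [← prefixProd_past_eq_future, sub_add_cancel]
    obtain ⟨j, hj⟩ := Nat.exists_eq_succ_of_ne_zero hm.ne'
    rw [hj]
    exact hz j
  · intro k hk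
    by_contra hc
    have hk0 : 0 < k := by
      rcases Nat.eq_zero_or_pos k with rfl | hk0
      · simp at hc
      · exact hk0
    have hmem : k ∈ {k | 0 < k ∧ prefixProd (future ω (z - m)) k < 1} := ⟨hk0, not_le.1 hc⟩
    have hle : firstDescent (future ω (z - m)) ≤ k := Nat.sInf_le hmem
    have hpos : 0 < firstDescent (future ω (z - m)) := (Nat.sInf_mem ⟨k, hmem⟩).1
    have hn := mem_ladderPast_next hl hpos
    refine Nat.find_min h (m := m - firstDescent (future ω (z - m))) (by omega) ⟨by omega, ?_⟩
    convert hn using 2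
    rw [Nat.cast_sub (by omega)]
    ring

/-- Summability leaves finitely many backward products that are at least `1`, so they attain a
maximum. The farthest maximizer is a ladder point: a product of at least `1` beyond it would give a
maximizer farther away. -/
lemma exists_ladder {ω : Env} {y : ℤ} (h : pastSum (past ω y) ≠ ∞) :
    ∃ k : ℕ, past ω (y - k) ∈ ladderPast := by
  set f := fun k => prefixProd (past ω y) k with hf
  have hfin : {k | 1 ≤ f k}.Finite := by
    have h1 := ENNReal.finite_const_le_of_tsum_ne_top (a := f)
      (by rw [tsum_eq_zero_add' ENNReal.summable]; finiteness [show
        ∑' b, f (b + 1) ≠ ∞ from h, show f 0 ≠ ∞ by simp [hf]]) one_ne_zero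
    exact h1
  obtain ⟨k₀, hk₀, hmax⟩ := Set.exists_max_image _ f hfin ⟨0, by simp [hf]⟩
  obtain ⟨k, hk, hkmax⟩ := Set.exists_max_image {k | f k₀ ≤ f k} id
    (hfin.subset fun k hk => (le_trans hk₀ hk : 1 ≤ f k)) ⟨k₀, le_refl (f k₀)⟩
  refine ⟨k, fun j => ?_⟩
  by_contra hc
  rw [← dropSeq_past, not_lt] at hc
  have h1 : f k ≤ f (k + (j + 1)) := by
    simp only [hf]
    rw [prefixProd_add]
    exact le_mul_of_one_le_right' hc
  have := hkmax (k + (j + 1)) (le_trans hk h1)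
  simp at this

/-- The law of the past sum at a ladder point. -/
def pastSumLaw (μ : Measure (Set.Icc (0 : ℝ) 1)) : Measure ℝ≥0∞ :=
  (cond (seqLaw μ) ladderPast).map pastSum

lemma lintegral_pastSumLaw (μ : Measure (Set.Icc (0 : ℝ) 1)) {f : ℝ≥0∞ → ℝ≥0∞} (hf : Measurable f) :
    ∫⁻ w, f w ∂pastSumLaw μ =
      (seqLaw μ ladderPast)⁻¹ * ∫⁻ ζ, ladderPast.indicator (fun ζ => f (pastSum ζ)) ζ ∂seqLaw μ := by
  rw [pastSumLaw, lintegral_map hf measurable_pastSum, ProbabilityTheory.cond, lintegral_smul_measure,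
    lintegral_indicator measurableSet_ladderPast, smul_eq_mul]

/-! ### Almost sure properties -/

section
variable {μ : Measure (Set.Icc (0 : ℝ) 1)} [IsProbabilityMeasure μ]

lemma lintegral_pastSum_ne_top (hr : ∫⁻ p, odds p ∂μ < 1) : ∫⁻ ζ, pastSum ζ ∂seqLaw μ ≠ ∞ := by
  unfold pastSum
  rw [lintegral_tsum fun k => by fun_prop]
  simp_rw [lintegral_prefixProd]
  rw [ENNReal.tsum_geometric_add_one]
  have : 1 - ∫⁻ p, odds p ∂μ ≠ 0 := (tsub_pos_of_lt hr).ne'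
  finiteness

lemma ae_pastSum_ne_top (hr : ∫⁻ p, odds p ∂μ < 1) : ∀ᵐ ζ ∂seqLaw μ, pastSum ζ ≠ ∞ :=
  (ae_lt_top measurable_pastSum (lintegral_pastSum_ne_top hr)).mono fun _ h => h.ne

lemma ae_firstDescent_pos (hr : ∫⁻ p, odds p ∂μ < 1) : ∀ᵐ η ∂seqLaw μ, 0 < firstDescent η := by
  filter_upwards [ae_pastSum_ne_top hr] with η hη
  by_contra hc
  have h1 : ∀ k, 1 ≤ prefixProd η (k + 1) := fun k => by
    by_contra hk
    have hmem : k + 1 ∈ {k | 0 < k ∧ prefixProd η k < 1} := ⟨Nat.succ_pos k, not_le.1 hk⟩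
    exact hc (Nat.sInf_mem ⟨_, hmem⟩).1
  refine hη (top_le_iff.1 ?_)
  calc ∞ = ∑' _ : ℕ, (1 : ℝ≥0∞) := (ENNReal.tsum_const_eq_top_of_ne_zero one_ne_zero).symm
    _ ≤ pastSum η := ENNReal.tsum_le_tsum h1

lemma measurePreserving_past (y : ℤ) :
    MeasurePreserving (fun ω : Env => past ω y) (envLaw μ) (seqLaw μ) :=
  measurePreserving_fst.comp (measurePreserving_past_future μ y)

lemma measurePreserving_future (y : ℤ) :
    MeasurePreserving (fun ω : Env => future ω y) (envLaw μ) (seqLaw μ) :=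
  measurePreserving_snd.comp (measurePreserving_past_future μ y)

lemma ae_env_pastSum_ne_top (hr : ∫⁻ p, odds p ∂μ < 1) :
    ∀ᵐ ω ∂envLaw μ, ∀ y, pastSum (past ω y) ≠ ∞ :=
  ae_all_iff.2 fun y => (measurePreserving_past y).quasiMeasurePreserving.ae (ae_pastSum_ne_top hr)

lemma seqLaw_ladderPast_ne_zero (hr : ∫⁻ p, odds p ∂μ < 1) : seqLaw μ ladderPast ≠ 0 := by
  intro h0
  have h1 : ∀ᵐ ω ∂envLaw μ, ∀ y, past ω y ∉ ladderPast :=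
    ae_all_iff.2 fun y => (measurePreserving_past y).quasiMeasurePreserving.ae
      (measure_eq_zero_iff_ae_notMem.1 h0)
  obtain ⟨ω, hω⟩ := (h1.and (ae_env_pastSum_ne_top hr)).exists
  obtain ⟨k, hk⟩ := exists_ladder (hω.2 0)
  exact hω.1 _ hk

/-! ### The chain of past sums at successive ladder points -/

lemma measurable_apply_nat {α β : Type*} [MeasurableSpace α] [MeasurableSpace β] {f : ℕ → α → β}
    (hf : ∀ n, Measurable (f n)) {g : α → ℕ} (hg : Measurable g) :
    Measurable fun a => f (g a) a :=
  (measurable_from_prod_countable_right (f := fun p : ℕ × α => f p.1 p.2) hf).comp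
    (hg.prodMk measurable_id)

@[fun_prop] lemma measurable_accum_firstDescent :
    Measurable fun z : ℝ≥0∞ × (ℕ → Set.Icc (0 : ℝ) 1) => accum z.1 z.2 (firstDescent z.2) :=
  measurable_apply_nat measurable_accum (measurable_firstDescent.comp measurable_snd)

@[fun_prop] lemma measurable_dropSeq_firstDescent :
    Measurable fun η => dropSeq (firstDescent η) η :=
  measurable_apply_nat measurable_dropSeq measurable_firstDescent

lemma isProbabilityMeasure_pastSumLaw (hr : ∫⁻ p, odds p ∂μ < 1) :
    IsProbabilityMeasure (pastSumLaw μ) := by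
  have := cond_isProbabilityMeasure (seqLaw_ladderPast_ne_zero hr)
  exact Measure.isProbabilityMeasure_map measurable_pastSum.aemeasurable

/-- Stationarity by mass transport: each ladder point sends its mass to the next one, and almost
surely each ladder point has exactly one predecessor. Translation invariance of `envLaw` then
equates the mass sent from `0` with the mass received at `0`. -/
theorem lintegral_pastSumLaw_accum (hr : ∫⁻ p, odds p ∂μ < 1) {f : ℝ≥0∞ → ℝ≥0∞}
    (hf : Measurable f) :
    ∫⁻ w, ∫⁻ η, f (accum w η (firstDescent η)) ∂seqLaw μ ∂pastSumLaw μ =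
      ∫⁻ w, f w ∂pastSumLaw μ := by
  have hF : Measurable fun z : ℝ≥0∞ × (ℕ → Set.Icc (0 : ℝ) 1) =>
      f (accum z.1 z.2 (firstDescent z.2)) := hf.comp measurable_accum_firstDescent
  have hF' : Measurable fun w => ∫⁻ η, f (accum w η (firstDescent η)) ∂seqLaw μ :=
    hF.lintegral_prod_right'
  rw [lintegral_pastSumLaw μ hF', lintegral_pastSumLaw μ hf]
  congr 1
  have hA : ∀ y, MeasurableSet {ω : Env | past ω y ∈ ladderPast} := fun y =>
    measurable_past y measurableSet_ladderPast
  have hf' : ∀ y, Measurable fun ω : Env => f (pastSum (past ω y)) := fun y =>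
    hf.comp (measurable_pastSum.comp (measurable_past y))
  let E : ℤ → ℕ → Set Env := fun x m =>
    {ω | past ω x ∈ ladderPast ∧ firstDescent (future ω x) = m}
  have hE : ∀ x m, MeasurableSet (E x m) := fun x m =>
    (hA x).inter (measurableSet_eq_fun (by fun_prop) (by fun_prop))
  calc ∫⁻ ζ, ladderPast.indicator
        (fun ζ => ∫⁻ η, f (accum (pastSum ζ) η (firstDescent η)) ∂seqLaw μ) ζ ∂seqLaw μ
      = ∫⁻ ζ, ∫⁻ η, (ladderPast ×ˢ Set.univ).indicator
          (fun z => f (accum (pastSum z.1) z.2 (firstDescent z.2))) (ζ, η) ∂seqLaw μ ∂seqLaw μ := by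
        refine lintegral_congr fun ζ => ?_
        by_cases h : ζ ∈ ladderPast
        · simp [h]
        · simp [h]
    _ = ∫⁻ ω, {ω : Env | past ω 0 ∈ ladderPast}.indicator
          (fun ω => f (pastSum (past ω (firstDescent (future ω 0))))) ω ∂envLaw μ := by
        have hG : Measurable ((ladderPast ×ˢ Set.univ).indicator
            (fun z : (ℕ → Set.Icc (0 : ℝ) 1) × (ℕ → Set.Icc (0 : ℝ) 1) =>
              f (accum (pastSum z.1) z.2 (firstDescent z.2)))) :=
          (hF.comp ((measurable_pastSum.comp measurable_fst).prodMk measurable_snd)).indicator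
            (measurableSet_ladderPast.prod .univ)
        rw [← lintegral_prod _ hG.aemeasurable,
          ← (measurePreserving_past_future μ 0).lintegral_comp hG]
        refine lintegral_congr fun ω => ?_
        by_cases h : past ω 0 ∈ ladderPast
        · rw [Set.indicator_of_mem (by simpa using h), Set.indicator_of_mem (by exact h)]
          simp only [accum_pastSum, zero_add]
        · rw [Set.indicator_of_notMem (by simpa using h), Set.indicator_of_notMem (by exact h)]
    _ = ∑' m : ℕ, ∫⁻ ω, (E 0 (m + 1)).indicator
          (fun ω => f (pastSum (past ω (m + 1 : ℕ)))) ω ∂envLaw μ := by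
        rw [← lintegral_tsum fun m => ((hf' _).indicator (hE _ _)).aemeasurable]
        refine lintegral_congr_ae ?_
        filter_upwards [(measurePreserving_future (μ := μ) 0).quasiMeasurePreserving.ae
          (ae_firstDescent_pos hr)] with ω hω
        obtain ⟨m, hm⟩ := Nat.exists_eq_succ_of_ne_zero hω.ne'
        rw [tsum_eq_single m]
        · by_cases h : past ω 0 ∈ ladderPast
          · rw [Set.indicator_of_mem (by exact h), Set.indicator_of_mem (by exact ⟨h, hm⟩), hm]
          · rw [Set.indicator_of_notMem (by exact h),
              Set.indicator_of_notMem (by exact fun hc => h hc.1)]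
        · intro m' hm'
          rw [Set.indicator_of_notMem]
          rintro ⟨-, hc⟩
          omega
    -- For each block length, the environment is translated so that the end of the block sits at the
    -- origin.
    _ = ∑' m : ℕ, ∫⁻ ω, (E (-(m + 1 : ℕ)) (m + 1)).indicator
          (fun ω => f (pastSum (past ω 0))) ω ∂envLaw μ := by
        refine tsum_congr fun m => ?_
        rw [← (measurePreserving_shift μ (-(m + 1 : ℕ))).lintegral_comp
          ((hf' _).indicator (hE _ _))]
        refine lintegral_congr fun ω => ?_
        have h1 : shift (-(m + 1 : ℕ)) ω ∈ E 0 (m + 1) ↔ ω ∈ E (-(m + 1 : ℕ)) (m + 1) := by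
          simp only [E, Set.mem_ofPred_eq, past_shift, future_shift, zero_add]
        by_cases h : ω ∈ E (-(m + 1 : ℕ)) (m + 1)
        · rw [Set.indicator_of_mem h, Set.indicator_of_mem (h1.2 h), past_shift, add_neg_cancel]
        · rw [Set.indicator_of_notMem h, Set.indicator_of_notMem fun hc => h (h1.1 hc)]
    -- Exactly one term survives when `0` is a ladder point (existence and uniqueness of the
    -- predecessor), and none survives otherwise.
    _ = ∫⁻ ω, {ω : Env | past ω 0 ∈ ladderPast}.indicator
          (fun ω => f (pastSum (past ω 0))) ω ∂envLaw μ := by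
        rw [← lintegral_tsum fun m => ((hf' _).indicator (hE _ _)).aemeasurable]
        refine lintegral_congr_ae ?_
        filter_upwards [ae_env_pastSum_ne_top (μ := μ) hr, (measurePreserving_future
          (μ := μ) 0).quasiMeasurePreserving.ae (ae_firstDescent_pos hr)] with ω hω _
        have hmem : ∀ m : ℕ, ω ∈ E (-(m + 1 : ℕ)) (m + 1) ↔
            past ω (0 - (m + 1 : ℕ)) ∈ ladderPast ∧
              firstDescent (future ω (0 - (m + 1 : ℕ))) = m + 1 := fun m => by
          rw [zero_sub]; rfl
        by_cases h : past ω 0 ∈ ladderPast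
        · obtain ⟨k, hk⟩ := exists_ladder (hω (-1))
          obtain ⟨m, hm0, hm⟩ := exists_previous_ladder h ⟨k + 1, Nat.succ_pos k, by
            convert hk using 2; push_cast; ring⟩
          obtain ⟨m, rfl⟩ := Nat.exists_eq_succ_of_ne_zero hm0.ne'
          rw [tsum_eq_single m]
          · rw [Set.indicator_of_mem ((hmem m).2 hm), Set.indicator_of_mem (by exact h)]
          intro m' hm'
          rw [Set.indicator_of_notMem]
          intro hc
          have := previous_ladder_unique (Nat.succ_pos m') hm0 ((hmem m').1 hc) hm
          omega
        · rw [Set.indicator_of_notMem (by exact h), ENNReal.tsum_eq_zero.2]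
          intro m
          rw [Set.indicator_of_notMem]
          intro hc
          obtain ⟨h1, h2⟩ := (hmem m).1 hc
          refine h ?_
          have h3 := mem_ladderPast_next h1 (by omega)
          rwa [h2, sub_add_cancel] at h3
    _ = ∫⁻ ζ, ladderPast.indicator (fun ζ => f (pastSum ζ)) ζ ∂seqLaw μ := by
        exact (measurePreserving_past (μ := μ) 0).lintegral_comp
          ((hf.comp measurable_pastSum).indicator measurableSet_ladderPast)

/-- The step from a ladder point to the next one. -/
def advance (z : ℝ≥0∞ × (ℕ → Set.Icc (0 : ℝ) 1)) : ℝ≥0∞ × (ℕ → Set.Icc (0 : ℝ) 1) :=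
  (accum z.1 z.2 (firstDescent z.2), dropSeq (firstDescent z.2) z.2)

@[fun_prop] lemma measurable_advance : Measurable advance :=
  measurable_accum_firstDescent.prodMk (measurable_dropSeq_firstDescent.comp measurable_snd)

lemma lintegral_advance (hr : ∫⁻ p, odds p ∂μ < 1) (w : ℝ≥0∞)
    {G : (ℕ → Set.Icc (0 : ℝ) 1) → ℝ≥0∞} (hG : Measurable G)
    (hdep : ∀ η η', 0 < firstDescent η → (∀ i < firstDescent η, η i = η' i) → G η = G η')
    {F : ℝ≥0∞ × (ℕ → Set.Icc (0 : ℝ) 1) → ℝ≥0∞} (hF : Measurable F) :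
    ∫⁻ η, G η * F (advance (w, η)) ∂seqLaw μ =
      ∫⁻ η, G η * ∫⁻ η', F (accum w η (firstDescent η), η') ∂seqLaw μ ∂seqLaw μ := by
  have hm : Measurable (Function.uncurry fun η η' : ℕ → Set.Icc (0 : ℝ) 1 =>
      G η * F (accum w η (firstDescent η), η')) :=
    (hG.comp measurable_fst).mul (hF.comp ((measurable_accum_firstDescent.comp
      (measurable_const.prodMk measurable_fst)).prodMk measurable_snd))
  have h := lintegral_dropSeq_firstDescent μ (ae_firstDescent_pos hr) hm (by
    intro η η' h0 h
    have : firstDescent η' = firstDescent η := (firstDescent_congr h0 h).1 rfl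
    ext η''
    rw [this, accum_congr w h, hdep η η' h0 h])
  refine h.trans (lintegral_congr fun η => ?_)
  rw [lintegral_const_mul]
  exact hF.comp measurable_prodMk_left

theorem measurePreserving_advance (hr : ∫⁻ p, odds p ∂μ < 1) :
    MeasurePreserving advance ((pastSumLaw μ).prod (seqLaw μ)) ((pastSumLaw μ).prod (seqLaw μ)) := by
  have := isProbabilityMeasure_pastSumLaw hr
  refine ⟨measurable_advance, Measure.ext_of_lintegral _ fun F hF => ?_⟩
  rw [lintegral_map hF measurable_advance, lintegral_prod _ hF.aemeasurable,
    lintegral_prod (fun z => F (advance z)) (hF.comp measurable_advance).aemeasurable,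
    ← lintegral_pastSumLaw_accum hr hF.lintegral_prod_right']
  refine lintegral_congr fun w => ?_
  have h := lintegral_advance hr w (G := fun _ => 1) measurable_const (fun _ _ _ _ => rfl) hF
  simpa using h

end

/-! ### Functionals of one block -/

/-- The mean crossing time of the first block of `z.2`, when `z.1` is the past sum at its start. -/
def blockCrossing (z : ℝ≥0∞ × (ℕ → Set.Icc (0 : ℝ) 1)) : ℝ≥0∞ :=
  ∑ j ∈ Finset.range (firstDescent z.2), (1 + 2 * accum z.1 z.2 (j + 1))

/-- The height of the first block. -/
def blockHeight (η : ℕ → Set.Icc (0 : ℝ) 1) : ℝ≥0∞ :=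
  ⨆ j, ⨆ (_ : j < firstDescent η), prefixProd η (j + 1)

/-- The coefficient of the past sum in `blockCrossing`. -/
def blockSlope (η : ℕ → Set.Icc (0 : ℝ) 1) : ℝ≥0∞ :=
  ∑ j ∈ Finset.range (firstDescent η), 2 * prefixProd η (j + 1)

/-- The part of the next past sum that comes from the first block. -/
def blockAccum (η : ℕ → Set.Icc (0 : ℝ) 1) : ℝ≥0∞ := accum 0 η (firstDescent η)

/-- The product of the odds over the first block. -/
def blockProd (η : ℕ → Set.Icc (0 : ℝ) 1) : ℝ≥0∞ := prefixProd η (firstDescent η)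

lemma accum_eq (w : ℝ≥0∞) (η : ℕ → Set.Icc (0 : ℝ) 1) (k : ℕ) :
    accum w η k = accum 0 η k + prefixProd η k * w := by
  induction k with
  | zero => simp [accum]
  | succ k ih => rw [accum, accum, ih, prefixProd_succ]; ring

/-- `accum 0 η k` is a sum of `k` products ending at position `k - 1`. Inside the block the omitted
prefixes are at least `1`, so each of these products is at most the full prefix product. -/
lemma accum_zero_le {η : ℕ → Set.Icc (0 : ℝ) 1} {k : ℕ} (hk : k ≤ firstDescent η) :
    accum 0 η k ≤ k * prefixProd η k := by
  induction k with
  | zero => simp [accum]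
  | succ k ih =>
    calc accum 0 η (k + 1) = odds (η k) * (1 + accum 0 η k) := rfl
      _ ≤ odds (η k) * (prefixProd η k + k * prefixProd η k) := by
        gcongr
        · exact one_le_prefixProd hk
        · exact ih (by omega)
      _ = (k + 1 : ℕ) * prefixProd η (k + 1) := by rw [prefixProd_succ]; push_cast; ring

lemma blockCrossing_eq (w : ℝ≥0∞) (η : ℕ → Set.Icc (0 : ℝ) 1) :
    blockCrossing (w, η) = blockCrossing (0, η) + blockSlope η * w := by
  simp only [blockCrossing, blockSlope, Finset.sum_mul, ← Finset.sum_add_distrib]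
  refine Finset.sum_congr rfl fun j _ => ?_
  rw [accum_eq]
  ring

lemma accum_firstDescent (w : ℝ≥0∞) (η : ℕ → Set.Icc (0 : ℝ) 1) :
    accum w η (firstDescent η) = blockAccum η + blockProd η * w := accum_eq _ _ _

@[fun_prop] lemma measurable_blockCrossing : Measurable blockCrossing :=
  measurable_apply_nat (f := fun n (z : ℝ≥0∞ × (ℕ → Set.Icc (0 : ℝ) 1)) =>
    ∑ j ∈ Finset.range n, (1 + 2 * accum z.1 z.2 (j + 1))) (fun n => by fun_prop)
    (measurable_firstDescent.comp measurable_snd)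

@[fun_prop] lemma measurable_blockHeight : Measurable blockHeight :=
  measurable_apply_nat (f := fun n η => ⨆ j, ⨆ (_ : j < n), prefixProd η (j + 1))
    (fun n => Measurable.iSup fun j => Measurable.iSup fun _ => by fun_prop) measurable_firstDescent

@[fun_prop] lemma measurable_blockSlope : Measurable blockSlope :=
  measurable_apply_nat (f := fun n η => ∑ j ∈ Finset.range n, 2 * prefixProd η (j + 1))
    (fun n => by fun_prop) measurable_firstDescent

@[fun_prop] lemma measurable_blockAccum : Measurable blockAccum :=
  measurable_accum_firstDescent.comp (measurable_const.prodMk measurable_id)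

@[fun_prop] lemma measurable_blockProd : Measurable blockProd :=
  measurable_apply_nat measurable_prefixProd measurable_firstDescent

lemma blockProd_le_one (η : ℕ → Set.Icc (0 : ℝ) 1) : blockProd η ≤ 1 := by
  rcases Nat.eq_zero_or_pos (firstDescent η) with h | h
  · simp [blockProd, h]
  · exact (firstDescent_spec h).le

lemma blockAccum_le (η : ℕ → Set.Icc (0 : ℝ) 1) : blockAccum η ≤ firstDescent η :=
  (accum_zero_le le_rfl).trans (mul_le_of_le_one_right' (blockProd_le_one η))

lemma natCast_firstDescent_le (η : ℕ → Set.Icc (0 : ℝ) 1) :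
    (firstDescent η : ℝ≥0∞) ≤ ∑' k, prefixProd η k :=
  calc (firstDescent η : ℝ≥0∞) = ∑ k ∈ Finset.range (firstDescent η), 1 := by simp
    _ ≤ ∑ k ∈ Finset.range (firstDescent η), prefixProd η k :=
      Finset.sum_le_sum fun k hk => one_le_prefixProd (Finset.mem_range.1 hk)
    _ ≤ _ := ENNReal.sum_le_tsum _

lemma blockSlope_le (η : ℕ → Set.Icc (0 : ℝ) 1) : blockSlope η ≤ 2 * pastSum η := by
  rw [blockSlope, ← Finset.mul_sum, pastSum]
  gcongr
  exact ENNReal.sum_le_tsum _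

lemma blockCrossing_zero_le (η : ℕ → Set.Icc (0 : ℝ) 1) :
    blockCrossing (0, η) ≤
      ∑' k, prefixProd η k + 2 * ∑' k, ((k + 1 : ℕ) : ℝ≥0∞) * prefixProd η (k + 1) :=
  calc blockCrossing (0, η)
      = firstDescent η + 2 * ∑ j ∈ Finset.range (firstDescent η), accum 0 η (j + 1) := by
        simp [blockCrossing, Finset.sum_add_distrib, Finset.mul_sum]
    _ ≤ ∑' k, prefixProd η k + 2 * ∑ j ∈ Finset.range (firstDescent η),
          ((j + 1 : ℕ) : ℝ≥0∞) * prefixProd η (j + 1) := by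
        gcongr with j hj
        · exact natCast_firstDescent_le η
        · exact accum_zero_le (Finset.mem_range.1 hj)
    _ ≤ _ := by
        gcongr
        exact ENNReal.sum_le_tsum _

/-! ### Means over one block -/

section
variable {μ : Measure (Set.Icc (0 : ℝ) 1)} [IsProbabilityMeasure μ]

lemma lintegral_tsum_prefixProd_ne_top (hr : ∫⁻ p, odds p ∂μ < 1) :
    ∫⁻ η, ∑' k, prefixProd η k ∂seqLaw μ ≠ ∞ := by
  rw [lintegral_tsum fun k => by fun_prop]
  simp_rw [lintegral_prefixProd]
  rw [ENNReal.tsum_geometric]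
  have : 1 - ∫⁻ p, odds p ∂μ ≠ 0 := (tsub_pos_of_lt hr).ne'
  finiteness

lemma lintegral_blockSlope_ne_top (hr : ∫⁻ p, odds p ∂μ < 1) :
    ∫⁻ η, blockSlope η ∂seqLaw μ ≠ ∞ := by
  refine ne_top_of_le_ne_top ?_ (lintegral_mono blockSlope_le)
  rw [lintegral_const_mul _ measurable_pastSum]
  finiteness [lintegral_pastSum_ne_top hr]

lemma lintegral_blockAccum_ne_top (hr : ∫⁻ p, odds p ∂μ < 1) :
    ∫⁻ η, blockAccum η ∂seqLaw μ ≠ ∞ :=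
  ne_top_of_le_ne_top (lintegral_tsum_prefixProd_ne_top hr)
    (lintegral_mono fun η => (blockAccum_le η).trans (natCast_firstDescent_le η))

lemma lintegral_blockCrossing_zero_ne_top (hr : ∫⁻ p, odds p ∂μ < 1) :
    ∫⁻ η, blockCrossing (0, η) ∂seqLaw μ ≠ ∞ := by
  refine ne_top_of_le_ne_top ?_ (lintegral_mono blockCrossing_zero_le)
  have hm : Measurable fun η => ∑' k, ((k + 1 : ℕ) : ℝ≥0∞) * prefixProd η (k + 1) :=
    Measurable.tsum fun k => by fun_prop
  have h2 : ∫⁻ η, ∑' k, ((k + 1 : ℕ) : ℝ≥0∞) * prefixProd η (k + 1) ∂seqLaw μ ≠ ∞ := by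
    rw [lintegral_tsum fun k => by fun_prop]
    simp_rw [lintegral_const_mul _ (measurable_prefixProd _), lintegral_prefixProd]
    generalize ∫⁻ p, odds p ∂μ = r at hr ⊢
    lift r to NNReal using hr.ne_top
    have hr' : r < 1 := by exact_mod_cast hr
    have hs : Summable fun k : ℕ => (k : NNReal) * r ^ k := by
      rw [← NNReal.summable_coe]
      have := summable_pow_mul_geometric_of_norm_lt_one (R := ℝ) 1 (r := r)
        (by simpa using hr')
      simpa using this
    have := (NNReal.summable_nat_add_iff 1).2 hs
    have h3 := ENNReal.tsum_coe_ne_top_iff_summable.2 this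
    push_cast at h3 ⊢
    exact h3
  rw [lintegral_add_right _ (by fun_prop), lintegral_const_mul _ hm]
  finiteness [lintegral_tsum_prefixProd_ne_top hr]

/-- The contraction behind the exponential bound: a block ends with product strictly below `1`, so
the mean cannot equal `1`. -/
lemma lintegral_blockProd_lt_one (hr : ∫⁻ p, odds p ∂μ < 1) :
    ∫⁻ η, blockProd η ∂seqLaw μ < 1 := by
  have hle : ∫⁻ η, blockProd η ∂seqLaw μ ≤ 1 := by
    simpa using lintegral_mono (μ := seqLaw μ) blockProd_le_one
  refine lt_of_le_of_ne hle fun heq => ?_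
  have hae : blockProd =ᵐ[seqLaw μ] fun _ => 1 :=
    ae_eq_of_ae_le_of_lintegral_le (Filter.Eventually.of_forall blockProd_le_one)
      (by rw [heq]; simp) (by fun_prop) (by rw [heq]; simp)
  obtain ⟨η, h1, h2⟩ := (hae.and (ae_firstDescent_pos hr)).exists
  exact (firstDescent_spec h2).ne h1

lemma lintegral_pastSumLaw_ne_top (hr : ∫⁻ p, odds p ∂μ < 1) : ∫⁻ w, w ∂pastSumLaw μ ≠ ∞ := by
  rw [lintegral_pastSumLaw μ (f := fun w => w) measurable_id]
  refine ENNReal.mul_ne_top (ENNReal.inv_ne_top.2 (seqLaw_ladderPast_ne_zero hr)) ?_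
  exact ne_top_of_le_ne_top (lintegral_pastSum_ne_top hr)
    (lintegral_mono fun ζ => Set.indicator_le_self _ _ _)

/-- The stationary equation for the mean past sum. -/
lemma lintegral_pastSumLaw_eq (hr : ∫⁻ p, odds p ∂μ < 1) :
    ∫⁻ w, w ∂pastSumLaw μ =
      ∫⁻ η, blockAccum η ∂seqLaw μ + (∫⁻ η, blockProd η ∂seqLaw μ) * ∫⁻ w, w ∂pastSumLaw μ := by
  have := isProbabilityMeasure_pastSumLaw hr
  have h := lintegral_pastSumLaw_accum hr (f := fun w => w) measurable_id
  nth_rw 1 [← h]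
  simp_rw [accum_firstDescent]
  have e : ∀ w : ℝ≥0∞, ∫⁻ η, (blockAccum η + blockProd η * w) ∂seqLaw μ =
      ∫⁻ η, blockAccum η ∂seqLaw μ + (∫⁻ η, blockProd η ∂seqLaw μ) * w := fun w => by
    rw [lintegral_add_left (by fun_prop), lintegral_mul_const _ (by fun_prop)]
  simp_rw [e]
  rw [lintegral_add_left (by fun_prop), lintegral_const_mul _ (by fun_prop)]
  simp

/-- The stationary mean crossing time of a block. -/
def blockMean (μ : Measure (Set.Icc (0 : ℝ) 1)) : ℝ≥0∞ :=
  ∫⁻ z, blockCrossing z ∂((pastSumLaw μ).prod (seqLaw μ))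

lemma blockMean_eq (hr : ∫⁻ p, odds p ∂μ < 1) :
    blockMean μ = ∫⁻ η, blockCrossing (0, η) ∂seqLaw μ +
      (∫⁻ η, blockSlope η ∂seqLaw μ) * ∫⁻ w, w ∂pastSumLaw μ := by
  have := isProbabilityMeasure_pastSumLaw hr
  rw [blockMean, lintegral_prod _ measurable_blockCrossing.aemeasurable]
  have e : ∀ w : ℝ≥0∞, ∫⁻ η, blockCrossing (w, η) ∂seqLaw μ =
      ∫⁻ η, blockCrossing (0, η) ∂seqLaw μ + (∫⁻ η, blockSlope η ∂seqLaw μ) * w := fun w => by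
    rw [lintegral_congr fun η => blockCrossing_eq w η, lintegral_add_right _ (by fun_prop), lintegral_mul_const _ (by fun_prop)]
  rw [lintegral_congr e, lintegral_add_left (by fun_prop), lintegral_const_mul _ (by fun_prop)]
  simp

lemma blockMean_ne_top (hr : ∫⁻ p, odds p ∂μ < 1) : blockMean μ ≠ ∞ := by
  rw [blockMean_eq hr]
  finiteness [lintegral_blockCrossing_zero_ne_top hr, lintegral_blockSlope_ne_top hr,
    lintegral_pastSumLaw_ne_top hr]

/-! ### Tails -/

/-- Markov's inequality for the prefix product, which is at least `1` as long as the block lasts. -/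
lemma seqLaw_lt_firstDescent_le (μ : Measure (Set.Icc (0 : ℝ) 1)) [IsProbabilityMeasure μ] (h : ℕ) :
    seqLaw μ {η | h < firstDescent η} ≤ (∫⁻ p, odds p ∂μ) ^ h := by
  have h1 := mul_meas_ge_le_lintegral (μ := seqLaw μ) (measurable_prefixProd h) 1
  rw [one_mul, lintegral_prefixProd] at h1
  exact (measure_mono fun η (hη : h < firstDescent η) => one_le_prefixProd hη).trans h1

lemma pastSum_eq_add (ζ : ℕ → Set.Icc (0 : ℝ) 1) (h : ℕ) :
    pastSum ζ = ∑ k ∈ Finset.range h, prefixProd ζ (k + 1) + ∑' k, prefixProd ζ (k + 1 + h) := by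
  induction h with
  | zero => simp [pastSum]
  | succ h ih =>
    rw [ih, Finset.sum_range_succ, tsum_eq_zero_add' ENNReal.summable, ← add_assoc, zero_add,
      add_comm 1 h]
    congr 2
    ext k
    congr 1
    omega

/-- At a ladder point each of the first `h` terms is below `1`. Exceeding `2 h` thus forces the
remainder above `h ≥ 1`, and the mean of the remainder is geometrically small in `h`. -/
lemma pastSumLaw_tail_le (μ : Measure (Set.Icc (0 : ℝ) 1)) [IsProbabilityMeasure μ]
    {h : ℕ} (hh : 1 ≤ h) :
    pastSumLaw μ {w | 2 * h < w} ≤ (seqLaw μ ladderPast)⁻¹ * (∫⁻ ζ, pastSum ζ ∂seqLaw μ) *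
      (∫⁻ p, odds p ∂μ) ^ h := by
  have hms : MeasurableSet {w : ℝ≥0∞ | 2 * h < w} := measurableSet_Ioi
  rw [← lintegral_indicator_one hms, lintegral_pastSumLaw μ (measurable_one.indicator hms),
    mul_assoc]
  gcongr
  have e : (∫⁻ ζ, pastSum ζ ∂seqLaw μ) * (∫⁻ p, odds p ∂μ) ^ h =
      ∫⁻ ζ, ∑' k, prefixProd ζ (k + 1 + h) ∂seqLaw μ := by
    unfold pastSum
    rw [lintegral_tsum fun k => by fun_prop, lintegral_tsum fun k => by fun_prop,
      ← ENNReal.tsum_mul_right]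
    simp_rw [lintegral_prefixProd, pow_add]
  rw [e]
  refine lintegral_mono fun ζ => ?_
  by_cases hζ : ζ ∈ ladderPast
  · rw [Set.indicator_of_mem hζ]
    by_cases hw : pastSum ζ ∈ {w : ℝ≥0∞ | 2 * h < w}
    · rw [Set.indicator_of_mem hw]
      have h1 : 2 * (h : ℝ≥0∞) < pastSum ζ := hw
      rw [pastSum_eq_add ζ h] at h1
      have h2 : ∑ k ∈ Finset.range h, prefixProd ζ (k + 1) ≤ h := by
        calc _ ≤ ∑ k ∈ Finset.range h, (1 : ℝ≥0∞) := Finset.sum_le_sum fun k _ => (hζ k).le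
          _ = h := by simp
      by_contra hc
      have h3 : ∑' k, prefixProd ζ (k + 1 + h) ≤ h :=
        (not_le.1 hc).le.trans
          (show (1 : ℝ≥0∞) ≤ h by exact_mod_cast hh)
      refine absurd h1 (not_lt.2 ?_)
      rw [two_mul]
      exact add_le_add h2 h3
    · rw [Set.indicator_of_notMem hw]
      exact zero_le
  · rw [Set.indicator_of_notMem hζ]
    exact zero_le

end

/-! ### The exponential bound -/

/-- The mean crossing time of the first block, kept only if the block is not too high. -/
def truncCrossing (b : ℝ) (z : ℝ≥0∞ × (ℕ → Set.Icc (0 : ℝ) 1)) : ℝ≥0∞ :=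
  {z : ℝ≥0∞ × (ℕ → Set.Icc (0 : ℝ) 1) | blockHeight z.2 ≤ ENNReal.ofReal b}.indicator
    blockCrossing z

/-- The states with a moderate past sum and a moderate first block. -/
def moderate (h : ℕ) : Set (ℝ≥0∞ × (ℕ → Set.Icc (0 : ℝ) 1)) :=
  {z | z.1 ≤ 2 * h ∧ firstDescent z.2 ≤ h}

lemma measurableSet_moderate (h : ℕ) : MeasurableSet (moderate h) :=
  (measurableSet_le measurable_fst measurable_const).inter
    (measurableSet_le (measurable_firstDescent.comp measurable_snd) measurable_const)

lemma measurable_truncCrossing (b : ℝ) : Measurable (truncCrossing b) :=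
  measurable_blockCrossing.indicator
    (measurableSet_le (measurable_blockHeight.comp measurable_snd) measurable_const)

lemma truncCrossing_le_blockCrossing (b : ℝ) (z : ℝ≥0∞ × (ℕ → Set.Icc (0 : ℝ) 1)) :
    truncCrossing b z ≤ blockCrossing z := Set.indicator_le_self _ _ _

lemma advance_fst_le {h : ℕ} {z : ℝ≥0∞ × (ℕ → Set.Icc (0 : ℝ) 1)} (hz : z ∈ moderate h) :
    (advance z).1 ≤ 3 * h := by
  obtain ⟨w, η⟩ := z
  obtain ⟨h1, h2⟩ : w ≤ 2 * h ∧ firstDescent η ≤ h := hz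
  calc (advance (w, η)).1 = blockAccum η + blockProd η * w := accum_firstDescent w η
    _ ≤ h + 1 * (2 * h) := by
      gcongr
      · exact (blockAccum_le η).trans (by exact_mod_cast h2)
      · exact blockProd_le_one η
    _ = 3 * h := by ring

lemma truncCrossing_le {h : ℕ} (hh : 1 ≤ h) {b : ℝ} (hb : 1 ≤ b)
    {z : ℝ≥0∞ × (ℕ → Set.Icc (0 : ℝ) 1)} (hz : z ∈ moderate h) :
    truncCrossing b z ≤ 7 * (h * h * ENNReal.ofReal b) := by
  obtain ⟨w, η⟩ := z
  obtain ⟨h1, h2⟩ : w ≤ 2 * h ∧ firstDescent η ≤ h := hz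
  have hB : 1 ≤ ENNReal.ofReal b := ENNReal.one_le_ofReal.2 hb
  have hH : (1 : ℝ≥0∞) ≤ h := by exact_mod_cast hh
  have h2' : (firstDescent η : ℝ≥0∞) ≤ h := by exact_mod_cast h2
  set B := ENNReal.ofReal b
  by_cases hM : blockHeight η ≤ B
  · calc truncCrossing b (w, η) ≤ blockCrossing (w, η) := truncCrossing_le_blockCrossing _ _
      -- The three terms bound the constant `1`, the part of the recursion created in the block, and
      -- the contribution of the initial past sum. They add up to `7 h B` for each of at most `h`
      -- sites.
      _ ≤ ∑ j ∈ Finset.range (firstDescent η), (h * B + 2 * (h * B + B * (2 * h))) := by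
        refine Finset.sum_le_sum fun j hj => ?_
        have hj' : j < firstDescent η := Finset.mem_range.1 hj
        have hp : prefixProd η (j + 1) ≤ B := by
          refine le_trans ?_ hM
          exact le_iSup₂_of_le (f := fun j (_ : j < firstDescent η) => prefixProd η (j + 1))
            j hj' le_rfl
        simp only
        rw [accum_eq]
        gcongr
        · calc (1 : ℝ≥0∞) = 1 * 1 := (one_mul 1).symm
            _ ≤ h * B := by gcongr
        · refine (accum_zero_le (by omega)).trans ?_
          gcongr
          omega
      _ = firstDescent η * (7 * (h * B)) := by
        rw [Finset.sum_const, Finset.card_range, nsmul_eq_mul]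
        ring
      _ ≤ h * (7 * (h * B)) := by gcongr
      _ = 7 * (h * h * B) := by ring
  · rw [truncCrossing, Set.indicator_of_notMem (by exact hM)]
    exact zero_le

/-- From `e ^ x ≤ 1 + x + x²` on `[0, 1]` and `u² ≤ u`: linearizing the exponential costs only a
factor `1 + δ`. -/
lemma exp_mul_le {δ u : ℝ} (hδ : 0 < δ) (hδ1 : δ ≤ 1) (hu : 0 ≤ u) (hu1 : u ≤ 1) :
    Real.exp (δ * u) ≤ 1 + δ * (1 + δ) * u := by
  have h0 : 0 ≤ δ * u := by positivity
  have h1 : δ * u ≤ 1 := mul_le_one₀ hδ1 hu hu1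
  have h := (abs_le.1 (Real.abs_exp_sub_one_sub_id_le (abs_le.2 ⟨by linarith, h1⟩))).2
  nlinarith [mul_nonneg (mul_nonneg hδ.le hδ.le) (mul_nonneg hu (sub_nonneg.2 hu1))]

/-- The exponential rate for given truncation levels. -/
def rate (δ c b : ℝ) (h : ℕ) : ℝ := δ / ((7 + 3 * c) * (h * h * b))

lemma rate_pos {δ c b : ℝ} {h : ℕ} (hδ : 0 < δ) (hc : 0 ≤ c) (hb : 1 ≤ b) (hh : 1 ≤ h) :
    0 < rate δ c b h := by
  have : (0 : ℝ) < h := by exact_mod_cast hh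
  unfold rate
  positivity

/-- The exponential weight of the first `N` blocks, as long as they are all moderate. -/
def expWeight (l b : ℝ) (h : ℕ) : ℕ → ℝ≥0∞ × (ℕ → Set.Icc (0 : ℝ) 1) → ℝ≥0∞
  | 0, _ => 1
  | N + 1, z => (moderate h).indicator
      (fun z => ENNReal.ofReal (Real.exp (l * (truncCrossing b z).toReal))) z *
        expWeight l b h N (advance z)

lemma measurable_expWeight (l b : ℝ) (h N : ℕ) : Measurable (expWeight l b h N) := by
  induction N with
  | zero => exact measurable_const
  | succ N ih =>
    refine Measurable.mul (Measurable.indicator ?_ (measurableSet_moderate h))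
      (ih.comp measurable_advance)
    have := measurable_truncCrossing b
    fun_prop

section
variable {μ : Measure (Set.Icc (0 : ℝ) 1)} [IsProbabilityMeasure μ]

/-- One step of the supermartingale. After linearization the mean is affine in `w`; `hslope` keeps
its slope below `c`, so the weight `c w` pays for the effect of the past sum on the present block
and on the next past sum, and `hκ` bounds the constant term. -/
lemma lintegral_exp_step_le (hr : ∫⁻ p, odds p ∂μ < 1) {δ c κ b : ℝ} {h : ℕ} (hδ : 0 < δ)
    (hδ1 : δ ≤ 1) (hc : 0 ≤ c) (hb : 1 ≤ b) (hh : 1 ≤ h)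
    (hslope : (1 + δ) * ((∫⁻ η, blockSlope η ∂seqLaw μ).toReal +
      c * (∫⁻ η, blockProd η ∂seqLaw μ).toReal) ≤ c)
    (hκ : (1 + δ) * ((∫⁻ η, blockCrossing (0, η) ∂seqLaw μ).toReal +
      c * (∫⁻ η, blockAccum η ∂seqLaw μ).toReal) ≤ κ) {w : ℝ≥0∞} (hw : w ≠ ∞) :
    ∫⁻ η, (moderate h).indicator (fun z => ENNReal.ofReal (Real.exp (rate δ c b h *
      ((truncCrossing b z).toReal + c * (advance z).1.toReal)))) (w, η) ∂seqLaw μ ≤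
      ENNReal.ofReal (Real.exp (rate δ c b h * (κ + c * w.toReal))) := by
  set l := rate δ c b h with hl
  have hlpos : 0 < l := rate_pos hδ hc hb hh
  have hhpos : (0 : ℝ) < h := by exact_mod_cast hh
  have hK : 0 < (7 + 3 * c) * (h * h * b) := by positivity
  have hlK : l * ((7 + 3 * c) * (h * h * b)) = δ := by
    rw [hl, rate, div_mul_cancel₀ _ hK.ne']
  have hX := lintegral_blockCrossing_zero_ne_top hr
  have hY := lintegral_blockSlope_ne_top hr
  have hS := lintegral_blockAccum_ne_top hr
  have hR := (lintegral_blockProd_lt_one hr).ne_top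
  have hpt : ∀ η, (moderate h).indicator (fun z => ENNReal.ofReal (Real.exp (l *
      ((truncCrossing b z).toReal + c * (advance z).1.toReal)))) (w, η) ≤
      1 + ENNReal.ofReal (l * (1 + δ)) * (blockCrossing (0, η) + blockSlope η * w +
        ENNReal.ofReal c * (blockAccum η + blockProd η * w)) := by
    intro η
    by_cases hz : (w, η) ∈ moderate h
    · rw [Set.indicator_of_mem hz, ← blockCrossing_eq, ← accum_firstDescent]
      have ht := truncCrossing_le hh hb hz
      have ha := advance_fst_le hz
      have htt : truncCrossing b (w, η) ≠ ∞ := ne_top_of_le_ne_top (by finiteness) ht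
      have hat : (advance (w, η)).1 ≠ ∞ := ne_top_of_le_ne_top (by finiteness) ha
      have ht' : (truncCrossing b (w, η)).toReal ≤ 7 * (h * h * b) := by
        have := ENNReal.toReal_mono (by finiteness) ht
        simpa [ENNReal.toReal_ofReal (zero_le_one.trans hb)] using this
      have ha' : (advance (w, η)).1.toReal ≤ 3 * (h * h * b) := by
        have := ENNReal.toReal_mono (by finiteness) ha
        simp only [ENNReal.toReal_mul, ENNReal.toReal_ofNat, ENNReal.toReal_natCast] at this
        refine this.trans ?_
        have h1 : (1 : ℝ) ≤ h := by exact_mod_cast hh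
        have : (h : ℝ) * 1 * 1 ≤ h * h * b := by gcongr
        linarith
      set t := (truncCrossing b (w, η)).toReal with htdef
      set a := (advance (w, η)).1.toReal with hadef
      have ht0 : 0 ≤ t := ENNReal.toReal_nonneg
      have ha0 : 0 ≤ a := ENNReal.toReal_nonneg
      -- The denominator in `rate` is the bound `7 h² b + c · 3 h² b` for `t + c a`, so that the
      -- exponent never exceeds `δ`.
      have hu : (t + c * a) / ((7 + 3 * c) * (h * h * b)) ≤ 1 := by
        rw [div_le_one hK]
        nlinarith
      have hexp := exp_mul_le hδ hδ1 (by positivity) hu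
      have e1 : δ * ((t + c * a) / ((7 + 3 * c) * (h * h * b))) = l * (t + c * a) := by
        rw [hl, rate]; ring
      have e2 : δ * (1 + δ) * ((t + c * a) / ((7 + 3 * c) * (h * h * b))) =
          l * (1 + δ) * (t + c * a) := by
        rw [hl, rate]; ring
      rw [e1, e2] at hexp
      calc ENNReal.ofReal (Real.exp (l * (t + c * a)))
          ≤ ENNReal.ofReal (1 + l * (1 + δ) * (t + c * a)) := ENNReal.ofReal_le_ofReal hexp
        _ = 1 + ENNReal.ofReal (l * (1 + δ)) * (truncCrossing b (w, η) +
              ENNReal.ofReal c * (advance (w, η)).1) := by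
            rw [ENNReal.ofReal_add zero_le_one (by positivity), ENNReal.ofReal_mul (by positivity),
              ENNReal.ofReal_add ht0 (by positivity), ENNReal.ofReal_mul hc, htdef, hadef,
              ENNReal.ofReal_toReal htt, ENNReal.ofReal_toReal hat, ENNReal.ofReal_one]
        _ ≤ _ := by
            gcongr
            · exact truncCrossing_le_blockCrossing _ _
            · exact le_rfl
    · rw [Set.indicator_of_notMem hz]
      exact zero_le
  refine (lintegral_mono hpt).trans ?_
  rw [lintegral_add_left measurable_const, lintegral_const_mul _ (by fun_prop),
    lintegral_add_left (by fun_prop), lintegral_add_left (by fun_prop),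
    lintegral_mul_const _ (by fun_prop), lintegral_const_mul _ (by fun_prop),
    lintegral_add_left (by fun_prop), lintegral_mul_const _ (by fun_prop)]
  rw [lintegral_one, measure_univ]
  set X := ∫⁻ η, blockCrossing (0, η) ∂seqLaw μ
  set Y := ∫⁻ η, blockSlope η ∂seqLaw μ
  set S := ∫⁻ η, blockAccum η ∂seqLaw μ
  set R := ∫⁻ η, blockProd η ∂seqLaw μ
  have hX0 : 0 ≤ X.toReal := ENNReal.toReal_nonneg
  have hY0 : 0 ≤ Y.toReal := ENNReal.toReal_nonneg
  have hS0 : 0 ≤ S.toReal := ENNReal.toReal_nonneg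
  have hR0 : 0 ≤ R.toReal := ENNReal.toReal_nonneg
  have hw0 : 0 ≤ w.toReal := ENNReal.toReal_nonneg
  have e : 1 + ENNReal.ofReal (l * (1 + δ)) * (X + Y * w + ENNReal.ofReal c * (S + R * w)) =
      ENNReal.ofReal (1 + l * (1 + δ) * (X.toReal + Y.toReal * w.toReal +
        c * (S.toReal + R.toReal * w.toReal))) := by
    have hg : 0 ≤ l * (1 + δ) := by positivity
    generalize l * (1 + δ) = g at hg ⊢
    rw [ENNReal.ofReal_add zero_le_one (by positivity), ENNReal.ofReal_mul hg,
      ENNReal.ofReal_add (by positivity) (by positivity),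
      ENNReal.ofReal_add (by positivity) (by positivity), ENNReal.ofReal_mul hY0,
      ENNReal.ofReal_mul hc, ENNReal.ofReal_add (by positivity) (by positivity),
      ENNReal.ofReal_mul hR0, ENNReal.ofReal_toReal hX, ENNReal.ofReal_toReal hY,
      ENNReal.ofReal_toReal hS, ENNReal.ofReal_toReal hR, ENNReal.ofReal_toReal hw,
      ENNReal.ofReal_one]
  rw [e]
  refine ENNReal.ofReal_le_ofReal (le_trans ?_ (Real.add_one_le_exp _))
  have h1 : (1 + δ) * (X.toReal + Y.toReal * w.toReal + c * (S.toReal + R.toReal * w.toReal)) ≤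
      κ + c * w.toReal := by
    have := mul_le_mul_of_nonneg_right hslope hw0
    nlinarith
  have := mul_le_mul_of_nonneg_left h1 hlpos.le
  linarith

lemma truncCrossing_congr (b : ℝ) (w : ℝ≥0∞) {η η' : ℕ → Set.Icc (0 : ℝ) 1}
    (h0 : 0 < firstDescent η) (h : ∀ i < firstDescent η, η i = η' i) :
    truncCrossing b (w, η) = truncCrossing b (w, η') := by
  have hl : firstDescent η' = firstDescent η := (firstDescent_congr h0 h).1 rfl
  have hb : blockHeight η' = blockHeight η := by
    unfold blockHeight
    rw [hl]
    refine iSup_congr fun j => iSup_congr fun hj => ?_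
    exact prefixProd_congr fun i hi => (h i (by omega)).symm
  have hc : blockCrossing (w, η') = blockCrossing (w, η) := by
    simp only [blockCrossing, hl]
    refine Finset.sum_congr rfl fun j hj => ?_
    have := Finset.mem_range.1 hj
    rw [accum_congr w fun i hi => (h i (by omega)).symm]
  by_cases hM : blockHeight η ≤ ENNReal.ofReal b
  · rw [truncCrossing, truncCrossing, Set.indicator_of_mem (by exact hM),
      Set.indicator_of_mem (by rw [← hb] at hM; exact hM), hc]
  · rw [truncCrossing, truncCrossing, Set.indicator_of_notMem (by exact hM),
      Set.indicator_of_notMem (by rw [← hb] at hM; exact hM)]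

/-- Integrating out the environment after the first block, the induction hypothesis at the new past
sum leaves a factor `exp (l c W)`, which is exactly what the one-step estimate includes. -/
theorem lintegral_expWeight_le (hr : ∫⁻ p, odds p ∂μ < 1) {δ c κ b : ℝ} {h : ℕ} (hδ : 0 < δ)
    (hδ1 : δ ≤ 1) (hc : 0 ≤ c) (hb : 1 ≤ b) (hh : 1 ≤ h)
    (hslope : (1 + δ) * ((∫⁻ η, blockSlope η ∂seqLaw μ).toReal +
      c * (∫⁻ η, blockProd η ∂seqLaw μ).toReal) ≤ c)
    (hκ : (1 + δ) * ((∫⁻ η, blockCrossing (0, η) ∂seqLaw μ).toReal +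
      c * (∫⁻ η, blockAccum η ∂seqLaw μ).toReal) ≤ κ) (N : ℕ) {w : ℝ≥0∞} (hw : w ≠ ∞) :
    ∫⁻ η, expWeight (rate δ c b h) b h N (w, η) ∂seqLaw μ ≤
      ENNReal.ofReal (Real.exp (rate δ c b h * (κ * N + c * w.toReal))) := by
  have hlpos : 0 < rate δ c b h := rate_pos hδ hc hb hh
  induction N generalizing w with
  | zero =>
    simp only [expWeight, lintegral_one, measure_univ]
    rw [ENNReal.one_le_ofReal]
    refine Real.one_le_exp ?_
    have : 0 ≤ w.toReal := ENNReal.toReal_nonneg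
    simp only [CharP.cast_eq_zero, mul_zero, zero_add]
    positivity
  | succ N ih =>
    set l := rate δ c b h
    have hm : Measurable ((moderate h).indicator
        fun z => ENNReal.ofReal (Real.exp (l * (truncCrossing b z).toReal))) := by
      refine Measurable.indicator ?_ (measurableSet_moderate h)
      have := measurable_truncCrossing b
      fun_prop
    have h1 := lintegral_advance hr w (G := fun η => (moderate h).indicator
      (fun z => ENNReal.ofReal (Real.exp (l * (truncCrossing b z).toReal))) (w, η))
      (hm.comp measurable_prodMk_left) (by
        intro η η' h0 hη
        have hl : firstDescent η' = firstDescent η := (firstDescent_congr h0 hη).1 rfl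
        simp only [Set.indicator, moderate, Set.mem_ofPred_eq, hl, truncCrossing_congr b w h0 hη])
      (measurable_expWeight l b h N)
    simp only [expWeight]
    rw [h1]
    calc _ ≤ ∫⁻ η, ENNReal.ofReal (Real.exp (l * (κ * N))) * (moderate h).indicator
          (fun z => ENNReal.ofReal (Real.exp (l *
            ((truncCrossing b z).toReal + c * (advance z).1.toReal)))) (w, η) ∂seqLaw μ := by
          refine lintegral_mono fun η => ?_
          by_cases hz : (w, η) ∈ moderate h
          · simp only [Set.indicator_of_mem hz]
            have hat : accum w η (firstDescent η) ≠ ∞ :=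
              ne_top_of_le_ne_top (by finiteness) (advance_fst_le hz)
            refine (mul_le_mul_right (ih hat) _).trans_eq ?_
            rw [← ENNReal.ofReal_mul (Real.exp_pos _).le, ← ENNReal.ofReal_mul (Real.exp_pos _).le,
              ← Real.exp_add, ← Real.exp_add]
            congr 2
            simp only [advance]
            ring
          · simp [Set.indicator_of_notMem hz]
      _ ≤ ENNReal.ofReal (Real.exp (l * (κ * N))) *
          ENNReal.ofReal (Real.exp (l * (κ + c * w.toReal))) := by
          rw [lintegral_const_mul']
          · gcongr
            exact lintegral_exp_step_le hr hδ hδ1 hc hb hh hslope hκ hw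
          · exact ENNReal.ofReal_ne_top
      _ = _ := by
          rw [← ENNReal.ofReal_mul (Real.exp_pos _).le, ← Real.exp_add]
          congr 2
          push_cast
          ring

lemma le_expWeight {l b t : ℝ} (hl : 0 ≤ l) {h N : ℕ} {z : ℝ≥0∞ × (ℕ → Set.Icc (0 : ℝ) 1)}
    (hh : 1 ≤ h) (hb : 1 ≤ b)
    (hz : ∀ i < N, advance^[i] z ∈ moderate h)
    (ht : ENNReal.ofReal t < ∑ i ∈ Finset.range N, truncCrossing b (advance^[i] z)) :
    ENNReal.ofReal (Real.exp (l * t)) ≤ expWeight l b h N z := by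
  have hfin : ∀ i ∈ Finset.range N, truncCrossing b (advance^[i] z) ≠ ∞ := fun i hi =>
    ne_top_of_le_ne_top (by finiteness) (truncCrossing_le hh hb (hz i (Finset.mem_range.1 hi)))
  have ht' : t ≤ ∑ i ∈ Finset.range N, (truncCrossing b (advance^[i] z)).toReal := by
    rw [← ENNReal.toReal_sum hfin]
    exact (ENNReal.ofReal_le_iff_le_toReal (ENNReal.sum_ne_top.2 hfin)).1 ht.le
  refine (ENNReal.ofReal_le_ofReal (Real.exp_le_exp.2 (mul_le_mul_of_nonneg_left ht' hl))).trans ?_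
  clear ht ht' hfin
  induction N generalizing z with
  | zero => simp [expWeight]
  | succ N ih =>
    rw [Finset.sum_range_succ', mul_add, Real.exp_add, mul_comm,
      ENNReal.ofReal_mul (Real.exp_pos _).le, expWeight,
      Set.indicator_of_mem (by simpa using hz 0 (Nat.succ_pos N))]
    simp only [Function.iterate_succ_apply, Function.iterate_zero, id]
    gcongr
    exact ih fun i hi => by simpa using hz (i + 1) (by omega)

/-- The upper large deviation bound for the truncated crossing times. -/
theorem measure_truncCrossing_sum_le (hr : ∫⁻ p, odds p ∂μ < 1) {δ c κ b : ℝ} {h : ℕ} (hδ : 0 < δ)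
    (hδ1 : δ ≤ 1) (hc : 0 ≤ c) (hb : 1 ≤ b) (hh : 1 ≤ h)
    (hslope : (1 + δ) * ((∫⁻ η, blockSlope η ∂seqLaw μ).toReal +
      c * (∫⁻ η, blockProd η ∂seqLaw μ).toReal) ≤ c)
    (hκ : (1 + δ) * ((∫⁻ η, blockCrossing (0, η) ∂seqLaw μ).toReal +
      c * (∫⁻ η, blockAccum η ∂seqLaw μ).toReal) ≤ κ) {N : ℕ} (hN : 1 ≤ N) (t : ℝ) :
    (pastSumLaw μ).prod (seqLaw μ) {z | ENNReal.ofReal t <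
        ∑ i ∈ Finset.range N, truncCrossing b (advance^[i] z)} ≤
      N * (((seqLaw μ ladderPast)⁻¹ * (∫⁻ ζ, pastSum ζ ∂seqLaw μ) + 1) *
        (∫⁻ p, odds p ∂μ) ^ h) +
      ENNReal.ofReal (Real.exp (rate δ c b h * (κ * N + c * (2 * h) - t))) := by
  have := isProbabilityMeasure_pastSumLaw hr
  set ν := (pastSumLaw μ).prod (seqLaw μ)
  set l := rate δ c b h
  have hlpos : 0 < l := rate_pos hδ hc hb hh
  have hbad : ν (moderate h)ᶜ ≤ ((seqLaw μ ladderPast)⁻¹ * (∫⁻ ζ, pastSum ζ ∂seqLaw μ) + 1) *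
        (∫⁻ p, odds p ∂μ) ^ h := by
    have hsub : (moderate h)ᶜ ⊆ ({w : ℝ≥0∞ | 2 * h < w} ×ˢ Set.univ) ∪
        (Set.univ ×ˢ {η | h < firstDescent η}) := by
      intro z hz
      by_contra hc
      simp only [Set.mem_union, Set.mem_prod, Set.mem_univ, and_true, true_and, not_or,
        Set.mem_ofPred_eq, not_lt] at hc
      exact hz hc
    refine (measure_mono hsub).trans ((measure_union_le _ _).trans ?_)
    rw [Measure.prod_prod, Measure.prod_prod, measure_univ, measure_univ, mul_one, one_mul, add_mul,
      one_mul]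
    exact add_le_add (pastSumLaw_tail_le μ hh) (seqLaw_lt_firstDescent_le μ h)
  have hadv : ∀ i, MeasurePreserving (advance^[i]) ν ν := fun i =>
    (measurePreserving_advance hr).iterate i
  -- Either one of the `N` states is not moderate, which stationarity makes equally unlikely for
  -- each `i`, or the exponential weight is large.
  have hsub : {z | ENNReal.ofReal t < ∑ i ∈ Finset.range N, truncCrossing b (advance^[i] z)} ⊆
      (⋃ i ∈ Finset.range N, advance^[i] ⁻¹' (moderate h)ᶜ) ∪
        {z | ENNReal.ofReal (Real.exp (l * t)) ≤ expWeight l b h N z} := by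
    intro z hz
    by_cases hg : ∀ i < N, advance^[i] z ∈ moderate h
    · exact Or.inr (le_expWeight hlpos.le hh hb hg hz)
    · push Not at hg
      obtain ⟨i, hi, hi'⟩ := hg
      exact Or.inl (Set.mem_biUnion (Finset.mem_range.2 hi) hi')
  refine (measure_mono hsub).trans ((measure_union_le _ _).trans (add_le_add ?_ ?_))
  · refine (measure_biUnion_finset_le _ _).trans ?_
    calc _ ≤ ∑ i ∈ Finset.range N, ν (moderate h)ᶜ := by
          refine Finset.sum_le_sum fun i _ => ?_
          rw [(hadv i).measure_preimage (measurableSet_moderate h).compl.nullMeasurableSet]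
      _ ≤ _ := by
          rw [Finset.sum_const, Finset.card_range, nsmul_eq_mul]
          gcongr
  · have hint : ∫⁻ z, expWeight l b h N z ∂ν ≤
        ENNReal.ofReal (Real.exp (l * (κ * N + c * (2 * h)))) := by
      rw [lintegral_prod _ (measurable_expWeight l b h N).aemeasurable]
      refine (lintegral_mono (g := fun _ =>
        ENNReal.ofReal (Real.exp (l * (κ * N + c * (2 * h))))) fun w => ?_).trans_eq (by simp)
      by_cases hw : w ≤ 2 * h
      · have hwt : w ≠ ∞ := ne_top_of_le_ne_top (by finiteness) hw
        refine (lintegral_expWeight_le hr hδ hδ1 hc hb hh hslope hκ N hwt).trans ?_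
        have hw' : w.toReal ≤ 2 * h := by simpa using ENNReal.toReal_mono (by finiteness) hw
        exact ENNReal.ofReal_le_ofReal (Real.exp_le_exp.2 (mul_le_mul_of_nonneg_left
          (by gcongr) hlpos.le))
      -- When `w > 2 h` the initial state is not moderate and, since `N ≥ 1`, the weight vanishes.
      · obtain ⟨N, rfl⟩ := Nat.exists_eq_succ_of_ne_zero (Nat.one_le_iff_ne_zero.1 hN)
        refine le_of_eq_of_le ((lintegral_congr fun η => ?_).trans lintegral_zero) zero_le
        rw [expWeight, Set.indicator_of_notMem (fun hc => hw hc.1), zero_mul]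
    have hmk := meas_ge_le_lintegral_div (μ := ν) (measurable_expWeight l b h N).aemeasurable
      (ε := ENNReal.ofReal (Real.exp (l * t))) (by simp [Real.exp_pos]) ENNReal.ofReal_ne_top
    refine hmk.trans ((ENNReal.div_le_div_right hint _).trans_eq ?_)
    rw [← ENNReal.ofReal_div_of_pos (Real.exp_pos _), ← Real.exp_sub]
    congr 2
    ring

end

/-! ### Ladder points in terms of one-sided environments -/

lemma rhoProd_eq_past (ω : Env) (y : ℤ) (k : ℕ) :
    rhoProd ω (y - k) (y - 1) = prefixProd (past ω y) k := by
  refine Finset.prod_nbij' (fun z => (y - 1 - z).toNat) (fun i => y - 1 - i) ?_ ?_ ?_ ?_ ?_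
  · intro z hz
    rw [Finset.mem_Icc] at hz
    rw [Finset.mem_range]
    omega
  · intro i hi
    rw [Finset.mem_range] at hi
    rw [Finset.mem_Icc]
    omega
  · intro z hz
    rw [Finset.mem_Icc] at hz
    omega
  · intro i _
    omega
  · intro z hz
    rw [Finset.mem_Icc] at hz
    simp only [rho, past]
    congr 2
    omega

lemma rhoProd_eq_future (ω : Env) (x : ℤ) (k : ℕ) :
    rhoProd ω x (x + k - 1) = prefixProd (future ω x) k := by
  refine Finset.prod_nbij' (fun z => (z - x).toNat) (fun i => x + i) ?_ ?_ ?_ ?_ ?_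
  · intro z hz
    rw [Finset.mem_Icc] at hz
    rw [Finset.mem_range]
    omega
  · intro i hi
    rw [Finset.mem_range] at hi
    rw [Finset.mem_Icc]
    omega
  · intro z hz
    rw [Finset.mem_Icc] at hz
    omega
  · intro i _
    omega
  · intro z hz
    rw [Finset.mem_Icc] at hz
    simp only [rho, future]
    congr 2
    omega

lemma forall_rhoProd_lt_one_iff (ω : Env) (y : ℤ) :
    (∀ k < y, rhoProd ω k (y - 1) < 1) ↔ past ω y ∈ ladderPast := by
  constructor
  · intro h k
    rw [← rhoProd_eq_past]
    exact h _ (by push_cast; omega)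
  · intro h k hk
    have := h (y - 1 - k).toNat
    rw [← rhoProd_eq_past] at this
    convert this using 2
    push_cast
    omega

lemma ladder_zero_of_mem {ω : Env} (h : past ω 0 ∈ ladderPast) : ladder ω 0 = 0 := by
  have : IsGreatest {y : ℤ | y ≤ 0 ∧ ∀ k < y, rhoProd ω k (y - 1) < 1} 0 :=
    ⟨⟨le_rfl, (forall_rhoProd_lt_one_iff ω 0).2 h⟩, fun y hy => hy.1⟩
  exact this.csSup_eq

/-- The supremum of an empty set of integers is also `0`; finiteness of the past sum supplies a
ladder point and excludes this case. -/
lemma mem_of_ladder_zero {ω : Env} (hW : pastSum (past ω 0) ≠ ∞) (h : ladder ω 0 = 0) :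
    past ω 0 ∈ ladderPast := by
  obtain ⟨k, hk⟩ := exists_ladder hW
  have hmem : sSup {y : ℤ | y ≤ 0 ∧ ∀ k < y, rhoProd ω k (y - 1) < 1} ∈
      {y : ℤ | y ≤ 0 ∧ ∀ k < y, rhoProd ω k (y - 1) < 1} :=
    Int.csSup_mem ⟨0 - k, by omega, (forall_rhoProd_lt_one_iff ω _).2 hk⟩ ⟨0, fun y hy => hy.1⟩
  have h0 : sSup {y : ℤ | y ≤ 0 ∧ ∀ k < y, rhoProd ω k (y - 1) < 1} = 0 := h
  rw [h0] at hmem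
  exact (forall_rhoProd_lt_one_iff ω 0).1 hmem.2

/-- The environment seen from `x`, with the left half summarized by the past sum. -/
def stateAt (ω : Env) (x : ℤ) : ℝ≥0∞ × (ℕ → Set.Icc (0 : ℝ) 1) :=
  (pastSum (past ω x), future ω x)

lemma measurable_stateAt (x : ℤ) : Measurable fun ω => stateAt ω x :=
  (measurable_pastSum.comp (measurable_past x)).prodMk (measurable_future x)

lemma advance_stateAt (ω : Env) (x : ℤ) :
    advance (stateAt ω x) = stateAt ω (x + firstDescent (future ω x)) := by
  simp only [advance, stateAt, accum_pastSum, dropSeq_future]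

lemma sInf_descent {ω : Env} {x : ℤ} (h : 0 < firstDescent (future ω x)) :
    sInf {z : ℤ | x < z ∧ rhoProd ω x (z - 1) < 1} = x + firstDescent (future ω x) := by
  refine IsLeast.csInf_eq ⟨⟨by omega, ?_⟩, ?_⟩
  · rw [rhoProd_eq_future]
    exact firstDescent_spec h
  · rintro z ⟨hz, hz1⟩
    have e : z - 1 = x + (z - x).toNat - 1 := by omega
    rw [e, rhoProd_eq_future] at hz1
    have : firstDescent (future ω x) ≤ (z - x).toNat := Nat.sInf_le ⟨by omega, hz1⟩
    omega

lemma ladderPos_succ_eq {ω : Env} (n : ℕ) (h : 0 < firstDescent (future ω (ladderPos ω n))) :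
    ladderPos ω (n + 1) = ladderPos ω n + firstDescent (future ω (ladderPos ω n)) := by
  rw [ladderPos]
  exact sInf_descent h

lemma advance_iterate_stateAt {ω : Env} (h0 : ladder ω 0 = 0)
    (hpos : ∀ i, 0 < firstDescent (advance^[i] (stateAt ω 0)).2) (n : ℕ) :
    advance^[n] (stateAt ω 0) = stateAt ω (ladderPos ω n) := by
  induction n with
  | zero =>
    have : ladderPos ω 0 = 0 := h0
    rw [this]
    rfl
  | succ n ih =>
    have h := hpos n
    rw [ih] at h
    rw [Function.iterate_succ_apply', ih, advance_stateAt, ladderPos_succ_eq n h]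

lemma height_eq {ω : Env} (n : ℕ) (h : 0 < firstDescent (future ω (ladderPos ω n))) :
    height ω n = blockHeight (future ω (ladderPos ω n)) := by
  have e : ladder ω ((n : ℤ) + 1) = ladderPos ω n + firstDescent (future ω (ladderPos ω n)) :=
    ladderPos_succ_eq n h
  have e0 : ladder ω (n : ℤ) = ladderPos ω n := rfl
  rw [height, e, e0]
  set x := ladderPos ω n
  refine le_antisymm (iSup₂_le fun j hj => ?_) (iSup₂_le fun j hj => ?_)
  · obtain ⟨h1, h2⟩ := hj
    have e2 : j = x + ((j - x).toNat + 1 : ℕ) - 1 := by push_cast; omega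
    rw [e2, rhoProd_eq_future]
    exact le_iSup₂_of_le (f := fun j (_ : j < firstDescent (future ω x)) =>
      prefixProd (future ω x) (j + 1)) (j - x).toNat (by omega) le_rfl
  · rw [← rhoProd_eq_future]
    exact le_iSup₂_of_le (f := fun j (_ : j ∈ Set.Ico x (x + firstDescent (future ω x))) =>
      rhoProd ω x j) (x + (j + 1 : ℕ) - 1) (by constructor <;> (push_cast; omega)) le_rfl

lemma crossing_eq {ω : Env} (hω : ∀ x, 0 < (ω x : ℝ)) (hW : ∀ x, pastSum (past ω x) ≠ ∞) (n : ℕ)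
    (h : 0 < firstDescent (future ω (ladderPos ω n))) :
    crossing ω n = blockCrossing (stateAt ω (ladderPos ω n)) := by
  have e : ladder ω ((n : ℤ) + 1) = ladderPos ω n + firstDescent (future ω (ladderPos ω n)) :=
    ladderPos_succ_eq n h
  have e0 : ladder ω (n : ℤ) = ladderPos ω n := rfl
  rw [crossing, e, e0, lintegral_hitTime_eq_accum ω hω hW]
  rfl

lemma smallCrossing_eq {ω : Env} (hω : ∀ x, 0 < (ω x : ℝ)) (hW : ∀ x, pastSum (past ω x) ≠ ∞)
    (b : ℝ) (n : ℕ) (h : 0 < firstDescent (future ω (ladderPos ω n))) :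
    smallCrossing b ω n = truncCrossing b (stateAt ω (ladderPos ω n)) := by
  by_cases hM : blockHeight (future ω (ladderPos ω n)) ≤ ENNReal.ofReal b
  · rw [smallCrossing, truncCrossing, Set.indicator_of_mem (by rw [← height_eq n h] at hM; exact hM),
      Set.indicator_of_mem (by exact hM), crossing_eq hω hW n h]
  · rw [smallCrossing, truncCrossing, Set.indicator_of_notMem (by rw [← height_eq n h] at hM; exact hM),
      Set.indicator_of_notMem (by exact hM)]

/-! ### The law of the environment conditioned on a ladder point at the origin -/

section
variable {μ : Measure (Set.Icc (0 : ℝ) 1)} [IsProbabilityMeasure μ]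

lemma ae_env_pos (hr : ∫⁻ p, odds p ∂μ < 1) : ∀ᵐ ω ∂envLaw μ, ∀ x, 0 < (ω x : ℝ) := by
  refine ae_all_iff.2 fun x => ?_
  have h : ∀ᵐ (p : Set.Icc (0 : ℝ) 1) ∂μ, 0 < (p : ℝ) := by
    filter_upwards [ae_lt_top measurable_odds hr.ne_top] with p hp
    refine lt_of_le_of_ne p.2.1 fun h0 => hp.ne ?_
    simp [odds, ← h0]
  exact (measurePreserving_eval_infinitePi (fun _ : ℤ => μ) x).quasiMeasurePreserving.ae h

lemma envLaw_ladderPast : envLaw μ {ω | past ω 0 ∈ ladderPast} = seqLaw μ ladderPast :=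
  (measurePreserving_past 0).measure_preimage measurableSet_ladderPast.nullMeasurableSet

lemma ladder_zero_ae_eq (hr : ∫⁻ p, odds p ∂μ < 1) :
    ({ω | ladder ω 0 = 0} : Set Env) =ᵐ[envLaw μ] {ω | past ω 0 ∈ ladderPast} := by
  filter_upwards [ae_env_pastSum_ne_top hr] with ω hω
  exact propext ⟨mem_of_ladder_zero (hω 0), ladder_zero_of_mem⟩

lemma envLaw_ladder_zero_ne_zero (hr : ∫⁻ p, odds p ∂μ < 1) :
    envLaw μ {ω | ladder ω 0 = 0} ≠ 0 := by
  rw [measure_congr (ladder_zero_ae_eq hr), envLaw_ladderPast]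
  exact seqLaw_ladderPast_ne_zero hr

lemma ladderLaw_eq (hr : ∫⁻ p, odds p ∂μ < 1) :
    ladderLaw μ = ProbabilityTheory.cond (envLaw μ) {ω | past ω 0 ∈ ladderPast} := by
  rw [ladderLaw, ProbabilityTheory.cond, ProbabilityTheory.cond,
    measure_congr (ladder_zero_ae_eq hr), Measure.restrict_congr_set (ladder_zero_ae_eq hr)]

/-- Up to a null set the conditioning event depends on the past alone, so the future keeps its
i.i.d. law and stays independent of the past sum. -/
lemma measurePreserving_stateAt (hr : ∫⁻ p, odds p ∂μ < 1) :
    MeasurePreserving (fun ω => stateAt ω 0) (ladderLaw μ)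
      ((pastSumLaw μ).prod (seqLaw μ)) := by
  have := isProbabilityMeasure_pastSumLaw hr
  have hA : MeasurableSet {ω : Env | past ω 0 ∈ ladderPast} :=
    measurable_past 0 measurableSet_ladderPast
  refine ⟨measurable_stateAt 0, Measure.ext_of_lintegral _ fun F hF => ?_⟩
  have hG : Measurable ((ladderPast ×ˢ Set.univ).indicator
      (fun z : (ℕ → Set.Icc (0 : ℝ) 1) × (ℕ → Set.Icc (0 : ℝ) 1) => F (pastSum z.1, z.2))) :=
    (hF.comp ((measurable_pastSum.comp measurable_fst).prodMk measurable_snd)).indicator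
      (measurableSet_ladderPast.prod .univ)
  rw [lintegral_map hF (measurable_stateAt 0), ladderLaw_eq hr, ProbabilityTheory.cond,
    lintegral_smul_measure, envLaw_ladderPast, ← lintegral_indicator hA,
    lintegral_prod _ hF.aemeasurable, lintegral_pastSumLaw μ hF.lintegral_prod_right', smul_eq_mul]
  congr 1
  calc _ = ∫⁻ ω, (ladderPast ×ˢ Set.univ).indicator
        (fun z : (ℕ → Set.Icc (0 : ℝ) 1) × (ℕ → Set.Icc (0 : ℝ) 1) => F (pastSum z.1, z.2))
        (past ω 0, future ω 0) ∂envLaw μ := by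
        refine lintegral_congr fun ω => ?_
        by_cases h : past ω 0 ∈ ladderPast
        · rw [Set.indicator_of_mem (by exact h), Set.indicator_of_mem (by simpa using h)]
          rfl
        · rw [Set.indicator_of_notMem (by exact h), Set.indicator_of_notMem (by simpa using h)]
    _ = _ := by
        rw [(measurePreserving_past_future μ 0).lintegral_comp hG,
          lintegral_prod _ hG.aemeasurable]
        refine lintegral_congr fun ζ => ?_
        by_cases h : ζ ∈ ladderPast
        · simp [h]
        · simp [h]

lemma isProbabilityMeasure_ladderLaw (hr : ∫⁻ p, odds p ∂μ < 1) :
    IsProbabilityMeasure (ladderLaw μ) :=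
  cond_isProbabilityMeasure (envLaw_ladder_zero_ne_zero hr)

lemma ae_ladderLaw_crossing (hr : ∫⁻ p, odds p ∂μ < 1) :
    ∀ᵐ ω ∂ladderLaw μ, ∀ n : ℕ,
      crossing ω n = blockCrossing (advance^[n] (stateAt ω 0)) ∧
        ∀ b, smallCrossing b ω n = truncCrossing b (advance^[n] (stateAt ω 0)) := by
  have := isProbabilityMeasure_pastSumLaw hr
  have hac : ladderLaw μ ≪ envLaw μ := cond_absolutelyContinuous
  have h0 : ∀ᵐ ω ∂ladderLaw μ, ladder ω 0 = 0 := by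
    have hA : MeasurableSet {ω : Env | past ω 0 ∈ ladderPast} :=
      measurable_past 0 measurableSet_ladderPast
    rw [ladderLaw_eq hr]
    filter_upwards [ae_cond_mem hA] with ω hω using ladder_zero_of_mem hω
  have hpos : ∀ᵐ ω ∂ladderLaw μ, ∀ i, 0 < firstDescent (advance^[i] (stateAt ω 0)).2 := by
    refine ae_all_iff.2 fun i => ?_
    have h1 : ∀ᵐ z ∂(pastSumLaw μ).prod (seqLaw μ), 0 < firstDescent z.2 :=
      (measurePreserving_snd (μ := pastSumLaw μ)
        (ν := seqLaw μ)).quasiMeasurePreserving.ae (ae_firstDescent_pos hr)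
    exact (((measurePreserving_advance hr).iterate i).comp
      (measurePreserving_stateAt hr)).quasiMeasurePreserving.ae h1
  filter_upwards [h0, hpos, hac.ae_le (ae_env_pos hr), hac.ae_le (ae_env_pastSum_ne_top hr)]
    with ω h0 hpos hω hW n
  have hn := hpos n
  rw [advance_iterate_stateAt h0 hpos] at hn ⊢
  exact ⟨crossing_eq hω hW n hn, fun b => smallCrossing_eq hω hW b n hn⟩

lemma meanCrossing_eq (hr : ∫⁻ p, odds p ∂μ < 1) : meanCrossing μ = blockMean μ := by
  rw [meanCrossing, blockMean,
    ← (measurePreserving_stateAt hr).lintegral_comp measurable_blockCrossing]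
  refine lintegral_congr_ae ?_
  filter_upwards [ae_ladderLaw_crossing hr] with ω hω using (hω 0).1

end

/-! ### Choice of the truncation levels -/

/-- Passes from the centred sum in `EReal` to an uncentred sum in `[0, ∞]`; the bound itself rules
out infinite terms. -/
lemma sum_coe_sub_le {N : ℕ} {f : ℕ → ℝ≥0∞} {m : ℝ≥0∞} (hm : m ≠ ∞) {t : ℝ} (ht : 0 ≤ t)
    (h : ∑ i ∈ Finset.range N, f i ≤ ENNReal.ofReal (N * m.toReal + t)) :
    ∑ i ∈ Finset.range N, ((f i : EReal) - (m : EReal)) ≤ (t : EReal) := by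
  have hfin : ∀ i ∈ Finset.range N, f i ≠ ∞ :=
    ENNReal.sum_ne_top.1 (ne_top_of_le_ne_top ENNReal.ofReal_ne_top h)
  have hm0 : 0 ≤ m.toReal := ENNReal.toReal_nonneg
  have h1 : ∑ i ∈ Finset.range N, (f i).toReal ≤ N * m.toReal + t := by
    rw [← ENNReal.toReal_sum hfin]
    exact ENNReal.toReal_le_of_le_ofReal (by positivity) h
  have h2 : ∑ i ∈ Finset.range N, ((f i : EReal) - (m : EReal)) =
      ((∑ i ∈ Finset.range N, ((f i).toReal - m.toReal) : ℝ) : EReal) := by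
    clear h h1
    induction N with
    | zero => simp
    | succ N ih =>
      rw [Finset.sum_range_succ, Finset.sum_range_succ, EReal.coe_add, EReal.coe_sub,
        EReal.coe_ennreal_toReal (hfin N (Finset.self_mem_range_succ N)),
        EReal.coe_ennreal_toReal hm,
        ih fun i hi => hfin i (Finset.range_mono (Nat.le_succ N) hi)]
  rw [h2, EReal.coe_le_coe_iff, Finset.sum_sub_distrib, Finset.sum_const, Finset.card_range,
    nsmul_eq_mul]
  linarith

/-- The parameters of the exponential bound can be chosen with a drift close to the mean. -/
lemma exists_drift {x y s r v : ℝ} (hy : 0 ≤ y) (hr1 : r < 1)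
    (hv : v = s + r * v) {ε : ℝ} (hε : 0 < ε) :
    ∃ δ c : ℝ, 0 < δ ∧ δ ≤ 1 ∧ 0 ≤ c ∧ (1 + δ) * (y + c * r) ≤ c ∧
      (1 + δ) * (x + c * s) ≤ x + y * v + ε := by
  have hr' : 1 - r ≠ 0 := by linarith
  have hv' : v = s / (1 - r) := by
    rw [eq_div_iff hr']
    linarith
  -- The choice of `c` solves `(1 + δ) (y + c r) = c`. At `δ = 0` it equals `y / (1 - r)` and the
  -- drift is exactly `x + y v`, so continuity leaves room for a small `δ > 0`.
  have hc1 : ContinuousAt (fun δ : ℝ => 1 - (1 + δ) * r) 0 := by fun_prop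
  have hc2 : ContinuousAt
      (fun δ : ℝ => (1 + δ) * (x + ((1 + δ) * y / (1 - (1 + δ) * r)) * s)) 0 := by
    refine ContinuousAt.mul (by fun_prop) (ContinuousAt.add (by fun_prop) (ContinuousAt.mul
      (ContinuousAt.div (by fun_prop) hc1 (by simpa using hr')) (by fun_prop)))
  have e1 : ∀ᶠ δ in nhds (0 : ℝ), 0 < 1 - (1 + δ) * r :=
    hc1.eventually (lt_mem_nhds (by simpa using hr1))
  have e2 : ∀ᶠ δ in nhds (0 : ℝ),
      (1 + δ) * (x + ((1 + δ) * y / (1 - (1 + δ) * r)) * s) < x + y * v + ε := by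
    refine hc2.eventually (gt_mem_nhds ?_)
    have : (1 + 0) * (x + ((1 + 0) * y / (1 - (1 + 0) * r)) * s) = x + y * v := by
      rw [hv']; ring
    linarith
  have e3 : ∀ᶠ δ in nhds (0 : ℝ), δ < 1 := gt_mem_nhds one_pos
  obtain ⟨δ, ⟨⟨h1, h2⟩, h3⟩, hδ⟩ := (((e1.and e2).and e3).filter_mono
    nhdsWithin_le_nhds |>.and (self_mem_nhdsWithin (s := Set.Ioi (0 : ℝ)))).exists
  have hδ0 : 0 < δ := hδ
  refine ⟨δ, (1 + δ) * y / (1 - (1 + δ) * r), hδ0, h3.le, by positivity, ?_, h2.le⟩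
  refine le_of_eq ?_
  field_simp
  ring

lemma eventually_mul_sq_le {D β : ℝ} (hβ : 0 < β) (k : ℕ) :
    ∀ᶠ y in Filter.atTop, D * y ^ k ≤ Real.exp (β * y) := by
  have h := (isLittleO_pow_exp_pos_mul_atTop k hβ).const_mul_left D
  filter_upwards [h.bound one_pos] with y hy
  rw [one_mul, Real.norm_eq_abs, Real.norm_eq_abs, Real.abs_exp] at hy
  exact (le_abs_self _).trans hy

/-- The exponent in the large deviation bound, for `h ≈ (log n) ^ 2`. -/
lemma eventually_exponent_le {δ c ε η₁ η₂ : ℝ} (hδ : 0 < δ) (hc : 0 ≤ c) (hε : 0 < ε)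
    (hη₂ : 0 < η₂) (hη : η₂ < η₁) :
    ∀ᶠ n : ℕ in Filter.atTop, ∀ h : ℕ, 1 ≤ h → (h : ℝ) ≤ Real.log n ^ 2 + 2 →
      rate δ c ((n : ℝ) ^ η₂) h * (c * (2 * h) - ε / 2 * (n : ℝ) ^ η₁) ≤ -Real.log n ^ 2 := by
  have hη₁ : 0 < η₁ := hη₂.trans hη
  have hlog : Filter.Tendsto (fun n : ℕ => Real.log n) Filter.atTop Filter.atTop :=
    Real.tendsto_log_atTop.comp tendsto_natCast_atTop_atTop
  -- With `L = log n` and `h ≤ 2 L²`, the first bound absorbs `2 c h ≤ 4 c L²` into a quarter of `ε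
  -- n ^ η₁`. The second beats `L²` times `h² ≤ 4 L⁴`, whence the sixth power, by the gain `n ^ (η₁
  -- - η₂)`.
  have e1 := hlog.eventually (eventually_mul_sq_le (D := 16 * c / ε) hη₁ 2)
  have e2 := hlog.eventually (eventually_mul_sq_le
    (D := 16 * (7 + 3 * c) / (δ * ε)) (sub_pos.2 hη) 6)
  filter_upwards [e1, e2, hlog.eventually_ge_atTop 2, Filter.eventually_ge_atTop 1]
    with n h1 h2 hn hn1 h hh hle
  have hn0 : (0 : ℝ) < n := by exact_mod_cast hn1
  set L := Real.log n with hL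
  have hhpos : (0 : ℝ) < h := by exact_mod_cast hh
  have hh2 : (h : ℝ) ≤ 2 * L ^ 2 := by nlinarith
  have ha : (n : ℝ) ^ η₁ = Real.exp (η₁ * L) := by
    rw [Real.rpow_def_of_pos hn0, mul_comm]
  have hb : (n : ℝ) ^ η₂ = Real.exp (η₂ * L) := by
    rw [Real.rpow_def_of_pos hn0, mul_comm]
  have hab : Real.exp (η₁ * L) = Real.exp ((η₁ - η₂) * L) * Real.exp (η₂ * L) := by
    rw [← Real.exp_add]; congr 1; ring
  rw [ha, hb, rate]
  have hE : 0 < Real.exp (η₂ * L) := Real.exp_pos _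
  have hK : 0 < (7 + 3 * c) * (h * h * Real.exp (η₂ * L)) := by positivity
  have h3 : c * (2 * h) - ε / 2 * Real.exp (η₁ * L) ≤ -(ε / 4 * Real.exp (η₁ * L)) := by
    have : c * (2 * h) ≤ ε / 4 * (16 * c / ε * L ^ 2) := by
      rw [show ε / 4 * (16 * c / ε * L ^ 2) = c * (2 * (2 * L ^ 2)) by field_simp; ring]
      gcongr
    have h4 := mul_le_mul_of_nonneg_left h1 (show 0 ≤ ε / 4 by positivity)
    linarith
  have h5 : L ^ 2 * ((7 + 3 * c) * (h * h * Real.exp (η₂ * L))) ≤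
      δ * (ε / 4 * Real.exp (η₁ * L)) := by
    calc L ^ 2 * ((7 + 3 * c) * (h * h * Real.exp (η₂ * L)))
        ≤ L ^ 2 * ((7 + 3 * c) * ((2 * L ^ 2) * (2 * L ^ 2) * Real.exp (η₂ * L))) := by gcongr
      _ = δ * (ε / 4 * ((16 * (7 + 3 * c) / (δ * ε) * L ^ 6) * Real.exp (η₂ * L))) := by
          field_simp; ring
      _ ≤ _ := by
          rw [hab]
          gcongr
  calc δ / ((7 + 3 * c) * (h * h * Real.exp (η₂ * L))) *
        (c * (2 * h) - ε / 2 * Real.exp (η₁ * L))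
      ≤ δ / ((7 + 3 * c) * (h * h * Real.exp (η₂ * L))) * -(ε / 4 * Real.exp (η₁ * L)) := by
        gcongr
    _ = -(δ * (ε / 4 * Real.exp (η₁ * L)) / ((7 + 3 * c) * (h * h * Real.exp (η₂ * L)))) := by
        ring
    _ ≤ -L ^ 2 := by
        rw [neg_le_neg_iff, le_div_iff₀ hK]
        exact h5

section
variable {μ : Measure (Set.Icc (0 : ℝ) 1)} [IsProbabilityMeasure μ]

/-- The large deviation bound for all large `n`. -/
lemma eventually_ladderLaw_sum_le (hr : ∫⁻ p, odds p ∂μ < 1) {η₁ η₂ ε : ℝ} (hη₂ : 0 < η₂)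
    (hη : η₂ < η₁) (hε : 0 < ε) :
    ∃ C C' : ℝ, 0 < C ∧ 0 < C' ∧ ∀ᶠ n : ℕ in Filter.atTop,
      ladderLaw μ {ω | ((ε * (n : ℝ) ^ η₁ : ℝ) : EReal) <
          ∑ i ∈ Finset.range ⌈(n : ℝ) ^ η₁⌉₊,
            ((smallCrossing ((n : ℝ) ^ η₂) ω (i : ℤ) : EReal) - (meanCrossing μ : EReal))} ≤
        ENNReal.ofReal (C' * (n : ℝ) ^ η₁ * Real.exp (-C * Real.log (n : ℝ) ^ 2)) := by
  have := isProbabilityMeasure_pastSumLaw hr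
  have hv := congrArg ENNReal.toReal (lintegral_pastSumLaw_eq hr)
  have hm := congrArg ENNReal.toReal (blockMean_eq hr)
  have hX := lintegral_blockCrossing_zero_ne_top hr
  have hY := lintegral_blockSlope_ne_top hr
  have hS := lintegral_blockAccum_ne_top hr
  have hR := (lintegral_blockProd_lt_one hr).ne_top
  have hV := lintegral_pastSumLaw_ne_top hr
  rw [ENNReal.toReal_add hS (by finiteness), ENNReal.toReal_mul] at hv
  rw [ENNReal.toReal_add hX (by finiteness), ENNReal.toReal_mul] at hm
  have hR1 : (∫⁻ η, blockProd η ∂seqLaw μ).toReal < 1 := by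
    have := (ENNReal.toReal_lt_toReal hR ENNReal.one_ne_top).2 (lintegral_blockProd_lt_one hr)
    simpa using this
  obtain ⟨δ, c, hδ, hδ1, hc, hslope, hκ⟩ := exists_drift
    (x := (∫⁻ η, blockCrossing (0, η) ∂seqLaw μ).toReal)
    (y := (∫⁻ η, blockSlope η ∂seqLaw μ).toReal) ENNReal.toReal_nonneg hR1
    hv (show 0 < ε / 4 by positivity)
  rw [← hm] at hκ
  set B := (seqLaw μ ladderPast)⁻¹ * (∫⁻ ζ, pastSum ζ ∂seqLaw μ) + 1 with hB
  have hBtop : B ≠ ∞ := by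
    have h1 : (seqLaw μ ladderPast)⁻¹ ≠ ∞ := ENNReal.inv_ne_top.2 (seqLaw_ladderPast_ne_zero hr)
    finiteness [lintegral_pastSum_ne_top hr]
  -- The maximum keeps `r` away from `0`, so that `r ^ h` can be written as an exponential.
  set r := max (∫⁻ p, odds p ∂μ).toReal (1 / 2) with hrdef
  have hr0 : 0 < r := lt_max_of_lt_right (by norm_num)
  have hr1 : r < 1 := max_lt (by
    have := (ENNReal.toReal_lt_toReal hr.ne_top ENNReal.one_ne_top).2 hr
    simpa using this) (by norm_num)
  have hrle : ∫⁻ p, odds p ∂μ ≤ ENNReal.ofReal r := by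
    rw [← ENNReal.ofReal_toReal hr.ne_top]
    exact ENNReal.ofReal_le_ofReal (le_max_left _ _)
  have hlogr : 0 < -Real.log r := neg_pos.2 (Real.log_neg hr0 hr1)
  -- `-log r` is the decay rate of the non-moderate states and `1` that of the exponential term. The
  -- factor `2` comes from `⌈a⌉ ≤ 2 a`, and the final `1` from the exponential term with `a ≥ 1`.
  refine ⟨min (-Real.log r) 1, 2 * B.toReal + 1, lt_min hlogr one_pos, by positivity, ?_⟩
  set C := min (-Real.log r) 1 with hC
  have hη₁ : 0 < η₁ := hη₂.trans hη
  filter_upwards [eventually_exponent_le hδ hc hε hη₂ hη, Filter.eventually_ge_atTop 1]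
    with n hn hn1
  have hn1' : (1 : ℝ) ≤ n := by exact_mod_cast hn1
  set a := (n : ℝ) ^ η₁ with ha
  have ha1 : 1 ≤ a := Real.one_le_rpow hn1' hη₁.le
  have hb1 : 1 ≤ (n : ℝ) ^ η₂ := Real.one_le_rpow hn1' hη₂.le
  set N := ⌈a⌉₊ with hN
  have hN1 : 1 ≤ N := Nat.one_le_iff_ne_zero.2 (Nat.ceil_pos.2 (by linarith)).ne'
  have hNa : (N : ℝ) ≤ 2 * a := by
    have := Nat.ceil_lt_add_one (show 0 ≤ a by linarith)
    linarith
  set L := Real.log n ^ 2 with hL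
  have hL0 : 0 ≤ L := sq_nonneg _
  set h := ⌈L⌉₊ + 1 with hh
  have hh1 : 1 ≤ h := Nat.le_add_left 1 _
  have hhL : L ≤ h := by
    have := Nat.le_ceil L
    rw [hh]; push_cast; linarith
  have hhL2 : (h : ℝ) ≤ L + 2 := by
    have := Nat.ceil_lt_add_one hL0
    rw [hh]; push_cast; linarith
  have hmean : meanCrossing μ = blockMean μ := meanCrossing_eq hr
  have hmt := blockMean_ne_top hr
  set m := (blockMean μ).toReal with hmdef
  have hchern := measure_truncCrossing_sum_le hr hδ hδ1 hc hb1 hh1 hslope hκ hN1 (N * m + ε * a)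
  have hQ : ladderLaw μ {ω | ((ε * a : ℝ) : EReal) < ∑ i ∈ Finset.range N,
      ((smallCrossing ((n : ℝ) ^ η₂) ω (i : ℤ) : EReal) - (meanCrossing μ : EReal))} ≤
      (pastSumLaw μ).prod (seqLaw μ) {z | ENNReal.ofReal (N * m + ε * a) <
        ∑ i ∈ Finset.range N, truncCrossing ((n : ℝ) ^ η₂) (advance^[i] z)} := by
    have hms : MeasurableSet {z | ENNReal.ofReal (N * m + ε * a) <
        ∑ i ∈ Finset.range N, truncCrossing ((n : ℝ) ^ η₂) (advance^[i] z)} :=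
      measurableSet_lt measurable_const (Finset.measurable_sum _ fun i _ =>
        (measurable_truncCrossing _).comp (measurable_advance.iterate i))
    rw [← (measurePreserving_stateAt hr).measure_preimage hms.nullMeasurableSet]
    refine measure_mono_ae ?_
    filter_upwards [ae_ladderLaw_crossing hr] with ω hω hω'
    by_contra hcon
    have hcon' : ∑ i ∈ Finset.range N, truncCrossing ((n : ℝ) ^ η₂) (advance^[i] (stateAt ω 0)) ≤
        ENNReal.ofReal (N * m + ε * a) := not_lt.1 hcon
    have hsum := sum_coe_sub_le hmt (by positivity) hcon'
    refine absurd hω' (not_lt.2 ?_)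
    simp only [(hω _).2, hmean]
    exact hsum
  refine hQ.trans (hchern.trans ?_)
  -- The drift excess `ε / 4` over `N ≤ 2 a` blocks uses half of the allowed deviation `ε a`; the
  -- other half remains as `-(ε / 2) a`.
  have hexpo : rate δ c ((n : ℝ) ^ η₂) h *
      ((m + ε / 4) * N + c * (2 * h) - (N * m + ε * a)) ≤ -L := by
    refine le_trans (mul_le_mul_of_nonneg_left ?_ (rate_pos hδ hc hb1 hh1).le) (hn h hh1 hhL2)
    have := mul_le_mul_of_nonneg_left hNa (show 0 ≤ ε / 4 by positivity)
    linarith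
  have hCL : Real.exp (-L) ≤ Real.exp (-C * L) := by
    refine Real.exp_le_exp.2 ?_
    have := mul_le_mul_of_nonneg_right (min_le_right (-Real.log r) 1) hL0
    linarith
  have hrh : r ^ h ≤ Real.exp (-C * L) := by
    rw [← Real.exp_log hr0, ← Real.exp_nat_mul]
    refine Real.exp_le_exp.2 ?_
    have h1 := mul_le_mul_of_nonneg_right (min_le_left (-Real.log r) 1) hL0
    have h2 := mul_le_mul_of_nonneg_left hhL hlogr.le
    linarith
  calc (N : ℝ≥0∞) * (B * (∫⁻ p, odds p ∂μ) ^ h) + ENNReal.ofReal (Real.exp (rate δ c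
        ((n : ℝ) ^ η₂) h * ((m + ε / 4) * N + c * (2 * h) - (N * m + ε * a))))
      ≤ ENNReal.ofReal (2 * a) * (ENNReal.ofReal B.toReal *
          ENNReal.ofReal (Real.exp (-C * L))) + ENNReal.ofReal (Real.exp (-C * L)) := by
        rw [ENNReal.ofReal_toReal hBtop]
        refine add_le_add (mul_le_mul' ?_ (mul_le_mul' le_rfl ?_))
          (ENNReal.ofReal_le_ofReal ((Real.exp_le_exp.2 hexpo).trans hCL))
        · rw [← ENNReal.ofReal_natCast]
          exact ENNReal.ofReal_le_ofReal hNa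
        · refine (pow_le_pow_left' hrle h).trans ?_
          rw [← ENNReal.ofReal_pow hr0.le]
          exact ENNReal.ofReal_le_ofReal hrh
    _ = ENNReal.ofReal (2 * a * (B.toReal * Real.exp (-C * L)) + Real.exp (-C * L)) := by
        rw [← ENNReal.ofReal_mul ENNReal.toReal_nonneg, ← ENNReal.ofReal_mul (by positivity),
          ← ENNReal.ofReal_add (by positivity) (by positivity)]
    _ ≤ _ := by
        refine ENNReal.ofReal_le_ofReal ?_
        have := mul_le_mul_of_nonneg_right ha1 (Real.exp_pos (-C * L)).le
        linarith

end

end RWRE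

end

/-! ### The theorem, with the bound extended to all `n ≥ 1` -/

theorem mainTheorem3
    (μ : MeasureTheory.Measure (Set.Icc (0 : ℝ) 1)) [MeasureTheory.IsProbabilityMeasure μ] (s : ℝ)
    (hball : RWRE.BallisticAssumption μ s) (hreg : RWRE.RegularityAssumption μ s)
    (η₁ η₂ : ℝ) (hη₂ : 0 < η₂) (hη : η₂ < η₁) :
    RWRE.envLaw μ {ω | RWRE.ladder ω 0 = 0} ≠ 0 ∧
    RWRE.meanCrossing μ ≠ ∞ ∧
    ∀ ε : ℝ, 0 < ε → ∃ C C' : ℝ, 0 < C ∧ 0 < C' ∧ ∀ n : ℕ, 1 ≤ n →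
      RWRE.ladderLaw μ {ω |
          ((ε * (n : ℝ) ^ η₁ : ℝ) : EReal) <
            ∑ i ∈ Finset.range ⌈(n : ℝ) ^ η₁⌉₊,
              ((RWRE.smallCrossing ((n : ℝ) ^ η₂) ω (i : ℤ) : EReal) -
                (RWRE.meanCrossing μ : EReal))} ≤
        ENNReal.ofReal (C' * (n : ℝ) ^ η₁ * Real.exp (-C * Real.log (n : ℝ) ^ 2)) := by
  have hr := RWRE.lintegral_odds_lt_one hball
  refine ⟨RWRE.envLaw_ladder_zero_ne_zero hr, ?_, fun ε hε => ?_⟩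
  · rw [RWRE.meanCrossing_eq hr]
    exact RWRE.blockMean_ne_top hr
  have := RWRE.isProbabilityMeasure_ladderLaw hr
  obtain ⟨C, C', hC, hC', hev⟩ := RWRE.eventually_ladderLaw_sum_le hr hη₂ hη hε
  obtain ⟨n₀, hn₀⟩ := Filter.eventually_atTop.1 hev
  -- For `n ≤ n₀` the enlarged constant makes the right side at least `1`, which bounds any
  -- probability.
  refine ⟨C, max C' (Real.exp (C * Real.log n₀ ^ 2)), hC, lt_max_of_lt_left hC', fun n hn => ?_⟩
  have hn1 : (1 : ℝ) ≤ n := by exact_mod_cast hn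
  rcases le_total n₀ n with h | h
  · refine (hn₀ n h).trans (ENNReal.ofReal_le_ofReal ?_)
    gcongr
    exact le_max_left _ _
  · refine MeasureTheory.prob_le_one.trans (ENNReal.one_le_ofReal.2 ?_)
    have ha : 1 ≤ (n : ℝ) ^ η₁ := Real.one_le_rpow hn1 (hη₂.trans hη).le
    have hlog : Real.log n ^ 2 ≤ Real.log n₀ ^ 2 := by
      have := Real.log_nonneg hn1
      have hle : (n : ℝ) ≤ n₀ := by exact_mod_cast h
      gcongr
    calc (1 : ℝ) = Real.exp (C * Real.log n ^ 2) * 1 * Real.exp (-C * Real.log n ^ 2) := by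
          rw [mul_one, ← Real.exp_add]; simp
      _ ≤ _ := by
          gcongr
          exact le_max_of_le_right (Real.exp_le_exp.2 (by gcongr))
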